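/- Let $\alpha<1$, $\beta>0$, $\lambda>0$, $\tau>0$ and $\tilde\theta\in\mathbb R$. All distributions below are conditional on the realization $\tilde\theta$ of a public signal. Consider a joint law of real random variables $(a_i,A,\theta)$: an agent's action, the aggregate action and the state. Call $\alpha A+\beta\theta$ the target. The action $a_i$ is a *direct signal* about the target if its conditional distribution given $(A,\theta)$ depends on $(A,\theta)$ only through $\alpha A+\beta\theta$. Given the law of $(A,\theta)$, it is *optimal* if it maximizes $$-\mathrm E\big[(a_i-(\alpha A+\beta\theta))^2\big]-\lambda\, I(\alpha A+\beta\theta;a_i)$$ among all direct signals about the target, of arbitrary distribution, where $I$ denotes mutual information. A joint law of $(a_i,A,\theta)$ is an *equilibrium* if 1. $(a_i,A,\theta)$ is jointly normal (possibly degenerate) with $\mathrm E[\theta]=\tilde\theta$ and $\mathrm{var}[\theta]=1/\tau$; 2. $a_i$ is an optimal direct signal; 3. $\mathrm E[a_i]=\mathrm E[A]$, $\mathrm{var}[A]=\mathrm{cov}[a_i,A]$ and $\mathrm{cov}[A,\theta]=\mathrm{cov}[a_i,\theta]$. The information fraction of an equilibrium is $\gamma=\mathrm{var}[a_i]/\mathrm{var}[\alpha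 A+\beta\theta]$. Put $$f(\gamma)=\frac{2\beta^2}{\lambda}\cdot\frac{1-\gamma}{(1-\alpha\gamma)^2}.$$ For each $\gamma>0$, there exists an equilibrium with information fraction $\gamma$ if and only if $\tau=f(\gamma)$; in particular, there exists an equilibrium with positive information fraction if and only if $\tau=f(\gamma)$ for some $\gamma>0$. There exists an equilibrium with $\gamma=0$ if and only if $\tau\ge f(0)$. Moreover: (i) If $\alpha\le 1/2$, there is exactly one equilibrium; it has $\gamma>0$ if $\tau<f(0)$ and $\gamma=0$ if $\tau\ge f(0)$. (ii) Suppose $\alpha>1/2$. (a) If $\tau<f(0)$ or $\tau>f((2\alpha-1)/\alpha)$, there is exactly one equilibrium; it has $\gamma>0$ in the former case and $\gamma=0$ in the latter. (b) If $\tau=f(0)$ or $\tau=f((2\alpha-1)/\alpha)$, there are exactly two equilibria, and $\gamma=0$ in exactly one of them. (c) If $f(0)<\tau<f((2\alpha-1)/\alpha)$, there are exactly three equilibria, and $\gamma=0$ in exactly one of them. In every equilibrium, $\mathrm E[a_i]=\mathrm E[A]=\beta\tilde\theta/(1-\alpha)$. In every equilibrium whose information fraction $\gamma$ satisfies $\tau=f(\gamma)$,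 $$A-\mathrm E[A]=\frac{\beta\gamma(\theta-\tilde\theta)}{1-\alpha\gamma}\ \text{ almost surely},\qquad \mathrm{var}[a_i]=\frac{\lambda\gamma}{2(1-\gamma)},$$ $$\mathrm{cov}[a_i,A]=\mathrm{var}[A]=\gamma\,\mathrm{var}[a_i]=\frac{\lambda\gamma^2}{2(1-\gamma)},$$ $$\mathrm{cov}[a_i,\theta]=\mathrm{cov}[A,\theta]=\frac{\mathrm{var}[a_i]-\alpha\,\mathrm{cov}[a_i,A]}{\beta}=\frac{\lambda\gamma(1-\alpha\gamma)}{2\beta(1-\gamma)}.$$ -/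

import Mathlib

open MeasureTheory ProbabilityTheory
open scoped ENNReal

namespace LQG

noncomputable section

/-- An outcome of the second-period subgame is a triple `(a_i, A, θ)`: the action of an agent, the
aggregate action, and the state. Its law is a measure on this space; everything is conditional on a
given realization of the public signal. -/
abbrev Outcome : Type := ℝ × ℝ × ℝ

/-- The agent's own action `a_i`. -/
def act (ω : Outcome) : ℝ := ω.1

/-- The aggregate action `A`. -/
def agg (ω : Outcome) : ℝ := ω.2.1

/-- The state `θ`. -/
def state (ω : Outcome) : ℝ := ω.2.2

/-- The target `α A + β θ` as a function of `(A, θ)`. -/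
def targetFn (α β : ℝ) (p : ℝ × ℝ) : ℝ := α * p.1 + β * p.2

theorem measurable_targetFn (α β : ℝ) : Measurable (targetFn α β) := by
  unfold targetFn
  fun_prop

/-- The target `α A + β θ` as a random variable on outcomes. -/
def target (α β : ℝ) (ω : Outcome) : ℝ := α * agg ω + β * state ω

/-- The mutual information `I(X; Y)` under `μ`: the Kullback-Leibler divergence of the joint law of
`(X, Y)` from the product of the marginal laws (equal to `∞` if it is not absolutely continuous). -/
def mutualInfo {Ω : Type*} [MeasurableSpace Ω] (μ : Measure Ω) (X Y : Ω → ℝ) : ℝ≥0∞ :=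
  InformationTheory.klDiv (μ.map fun ω => (X ω, Y ω)) ((μ.map X).prod (μ.map Y))

/-- The cost `λ · I(α A + β θ; a_i)` of the direct signal `a_i`. -/
def infoCost (α β lam : ℝ) (μ : Measure Outcome) : ℝ≥0∞ :=
  ENNReal.ofReal lam * mutualInfo μ (target α β) act

/-- The mean squared distance `E[(a_i - (α A + β θ))²]` of the action from the target. -/
def quadLoss (α β : ℝ) (μ : Measure Outcome) : ℝ≥0∞ :=
  ∫⁻ ω, ENNReal.ofReal ((act ω - target α β ω) ^ 2) ∂μ

/-- The agent's objective `-E[(a_i - (α A + β θ))²] - λ · I(α A + β θ; a_i)`. Both terms are at most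
zero, and the value is `-∞` if the loss or the cost is infinite. -/
def objective (α β lam : ℝ) (μ : Measure Outcome) : EReal :=
  -(quadLoss α β μ : EReal) - (infoCost α β lam μ : EReal)

/-- Under `μ`, the action `a_i` is a (possibly noisy) signal about the target `α A + β θ`: it is
drawn from a distribution that depends on `(A, θ)` only through the target. In other words, `a_i`
and `(A, θ)` are conditionally independent given `α A + β θ`. -/
def IsTargetSignal (α β : ℝ) (μ : Measure Outcome) : Prop :=
  ∃ κ : Kernel ℝ ℝ, IsMarkovKernel κ ∧
    μ = ((μ.map Prod.snd) ⊗ₘ (κ.comap (targetFn α β) (measurable_targetFn α β))).map Prod.swap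

/-- Under `μ`, the action `a_i` is an optimal direct signal: it is a signal about the target, and it
maximizes the objective among all signals about the target, with arbitrary distribution, the law of
`(A, θ)` being given. -/
def IsOptimalSignal (α β lam : ℝ) (μ : Measure Outcome) : Prop :=
  IsTargetSignal α β μ ∧
    ∀ μ' : Measure Outcome, IsProbabilityMeasure μ' → IsTargetSignal α β μ' →
      μ'.map Prod.snd = μ.map Prod.snd → objective α β lam μ' ≤ objective α β lam μ

/-- Symmetric Gaussian equilibrium of the second-period subgame, given the public signal `m` and the
precision `τ`. Gaussian laws may be degenerate. -/
structure IsEquilibrium (α β lam τ m : ℝ) (μ : Measure Outcome) : Prop where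
  gaussian : IsGaussian μ
  mean_state : ∫ ω, state ω ∂μ = m
  var_state : Var[state; μ] = 1 / τ
  optimal : IsOptimalSignal α β lam μ
  mean_eq : ∫ ω, act ω ∂μ = ∫ ω, agg ω ∂μ
  var_agg : Var[agg; μ] = cov[act, agg; μ]
  cov_state : cov[agg, state; μ] = cov[act, state; μ]

/-- The set of equilibria (as joint laws). -/
def equilibria (α β lam τ m : ℝ) : Set (Measure Outcome) :=
  {μ | IsEquilibrium α β lam τ m μ}

/-- The information fraction `γ = var[a_i] / var[α A + β θ]`. -/
def infoFraction (α β : ℝ) (μ : Measure Outcome) : ℝ :=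
  Var[act; μ] / Var[target α β; μ]

/-- `f(γ) = (2β²/λ) (1 - γ) / (1 - αγ)²`. -/
def f (α β lam γ : ℝ) : ℝ :=
  2 * β ^ 2 / lam * ((1 - γ) / (1 - α * γ) ^ 2)

end

end LQG

/-! In an equilibrium the target `T = αA + βθ` is Gaussian, say `N(m, v)`, so the agent solves a
Gaussian rate-distortion problem. Let `r` be the residual variance of the linear regression of `T`
on an action of arbitrary distribution. The information is at least `log (v / r) / 2`, by the
Donsker–Varadhan inequality with a Gaussian log density ratio as test function. The mean squared
error is `r` plus two squares that measure bias and wrong scaling (`residual_bound`). Minimizing `r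
+ λ/2 · log (v / r)` over `0 < r ≤ v` gives the unique minimizer `r = min v (λ/2)`. The bound is
attained by a linear signal with Gaussian noise (`neg_optimalCost_le_objective_optimalSignal`).
Hence every optimal action has the mean of `T`, variance `v - min v (λ/2)`, and covariance with `T`
equal to its variance (`moments_of_isOptimalSignal`).

Since `a_i` depends on `(A, θ)` only through `T`, joint normality gives `cov[a_i, Y] = γ cov[T, Y]`
for `Y = A` and `Y = θ` (`variance_target_mul_covariance`). The consistency conditions turn this
into linear equations for `cov[A, θ]` and `var[A]`, whose solution expresses all moments through
`γ`, with `v = β² / (τ (1 - αγ)²)`. The remaining condition `(1 - γ) v = min v (λ/2)` says `τ = f γ`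
if `γ > 0` and `f 0 ≤ τ` if `γ = 0` (`IsEquilibrium.hasMoments`). Conversely every such `γ` is
realized, with `A` affine in `θ` (`exists_equilibrium`).

A Gaussian law is determined by its moments, so `γ` identifies the equilibrium. Counting equilibria
therefore means counting the roots in `(0, 1)` of the quadratic equation `τ (1 - αγ)² = f 0 · (1 -
γ)`, and adding `γ = 0` when `f 0 ≤ τ`. -/

namespace LQG

open scoped NNReal

/-! ### Divergence bounds and the information of Gaussian signals. -/

section Information

/-- Donsker–Varadhan lower bound on the Kullback–Leibler divergence, for a tilting function with
normalized exponential. -/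
theorem integral_le_toReal_klDiv {Ω : Type*} [MeasurableSpace Ω] {P Q : Measure Ω}
    [IsProbabilityMeasure P] [IsProbabilityMeasure Q] {F : Ω → ℝ}
    (hP : Integrable F P) (hQ : Integrable (fun x => Real.exp (F x)) Q)
    (h1 : ∫ x, Real.exp (F x) ∂Q = 1) (hkl : InformationTheory.klDiv P Q ≠ ∞) :
    ∫ x, F x ∂P ≤ (InformationTheory.klDiv P Q).toReal := by
  obtain ⟨hac, hint⟩ := InformationTheory.klDiv_ne_top_iff.1 hkl
  have : IsProbabilityMeasure (Q.tilted F) := isProbabilityMeasure_tilted hQ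
  -- Gibbs' inequality for `P` against the tilted measure. The normalizing constant is 1, so this
  -- log-likelihood ratio is that of `P` and `Q` minus `F`.
  have h := InformationTheory.integral_llr_add_sub_measure_univ_nonneg
    (hac.trans (absolutelyContinuous_tilted hQ)) (integrable_llr_tilted_right hac hP hint hQ)
  rw [integral_llr_tilted_right hac hP hQ hint, h1] at h
  rw [InformationTheory.toReal_klDiv_of_measure_eq hac (by simp)]
  simp at h
  linarith

/-- The logarithm of the ratio of the densities at `x` of `N(a, D)` and `N(m, v)`. -/
noncomputable def logRatio (m v a D x : ℝ) : ℝ :=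
  1 / 2 * Real.log (v / D) - (x - a) ^ 2 / (2 * D) + (x - m) ^ 2 / (2 * v)

theorem gaussianPDFReal_mul_exp_logRatio (m a : ℝ) {v D : ℝ≥0} (hv : v ≠ 0) (hD : D ≠ 0) (x : ℝ) :
    gaussianPDFReal m v x * Real.exp (logRatio m v a D x) = gaussianPDFReal a D x := by
  have hv' : (0 : ℝ) < v := by positivity
  have hD' : (0 : ℝ) < D := by positivity
  have hpi := Real.pi_pos
  have h1 : Real.exp (1 / 2 * Real.log (v / D)) = √(v / D) := by
    rw [Real.sqrt_eq_rpow, Real.rpow_def_of_pos (by positivity), mul_comm]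
  simp only [gaussianPDFReal, logRatio]
  rw [Real.exp_add, Real.exp_sub, h1, neg_div, neg_div, Real.exp_neg, Real.exp_neg,
    Real.sqrt_div hv'.le, Real.sqrt_mul (by positivity), Real.sqrt_mul (by positivity)]
  rw [Real.sqrt_mul (x := 2 * Real.pi) (by positivity), Real.sqrt_mul (x := 2) (by positivity)]
  field_simp

theorem gaussianPDF_mul_exp_logRatio (m a : ℝ) {v D : ℝ≥0} (hv : v ≠ 0) (hD : D ≠ 0) (x : ℝ) :
    gaussianPDF m v x * ENNReal.ofReal (Real.exp (logRatio m v a D x)) = gaussianPDF a D x := by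
  rw [gaussianPDF, gaussianPDF, ← ENNReal.ofReal_mul (gaussianPDFReal_nonneg _ _ _),
    gaussianPDFReal_mul_exp_logRatio m a hv hD]

theorem measurable_logRatio {Ω : Type*} [MeasurableSpace Ω] {a x : Ω → ℝ} (m v D : ℝ)
    (ha : Measurable a) (hx : Measurable x) :
    Measurable fun ω => logRatio m v (a ω) D (x ω) := by
  unfold logRatio
  fun_prop

theorem gaussianReal_withDensity_exp_logRatio (m a : ℝ) {v D : ℝ≥0} (hv : v ≠ 0) (hD : D ≠ 0) :
    (gaussianReal m v).withDensity
      (fun x => ENNReal.ofReal (Real.exp (logRatio m v a D x))) = gaussianReal a D := by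
  have hm : Measurable fun x => ENNReal.ofReal (Real.exp (logRatio m v a D x)) :=
    (measurable_logRatio m v D measurable_const measurable_id).exp.ennreal_ofReal
  rw [gaussianReal_of_var_ne_zero _ hv, gaussianReal_of_var_ne_zero _ hD,
    ← withDensity_mul _ (measurable_gaussianPDF m v) hm]
  congr 1
  ext x
  exact gaussianPDF_mul_exp_logRatio m a hv hD x

theorem integrable_sq_of_memLp {Ω : Type*} [MeasurableSpace Ω] {μ : Measure Ω}
    [IsFiniteMeasure μ] {X Y : Ω → ℝ} (hX : MemLp X 2 μ) (hY : MemLp Y 2 μ) (p q r : ℝ) :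
    Integrable (fun ω => (p + q * X ω + r * Y ω) ^ 2) μ :=
  (((memLp_const p).add (hX.const_mul q)).add (hY.const_mul r)).integrable_sq

theorem integrable_logRatio {Ω : Type*} [MeasurableSpace Ω] {μ : Measure Ω}
    [IsFiniteMeasure μ] {x a : Ω → ℝ} {m : ℝ} (v D : ℝ)
    (i1 : Integrable (fun ω => (x ω - a ω) ^ 2) μ) (i2 : Integrable (fun ω => (x ω - m) ^ 2) μ) :
    Integrable (fun ω => logRatio m v (a ω) D (x ω)) μ :=
  ((integrable_const _).sub (i1.div_const _)).add (i2.div_const _)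

theorem integral_logRatio {Ω : Type*} [MeasurableSpace Ω] {μ : Measure Ω}
    [IsProbabilityMeasure μ] {x a : Ω → ℝ} {m : ℝ} (v D : ℝ)
    (i1 : Integrable (fun ω => (x ω - a ω) ^ 2) μ) (i2 : Integrable (fun ω => (x ω - m) ^ 2) μ) :
    ∫ ω, logRatio m v (a ω) D (x ω) ∂μ = 1 / 2 * Real.log (v / D)
      - (∫ ω, (x ω - a ω) ^ 2 ∂μ) / (2 * D) + (∫ ω, (x ω - m) ^ 2 ∂μ) / (2 * v) := by
  have j : Integrable (fun ω => 1 / 2 * Real.log (v / D) - (x ω - a ω) ^ 2 / (2 * D)) μ :=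
    (integrable_const _).sub (i1.div_const _)
  simp only [logRatio]
  rw [integral_add j (i2.div_const _), integral_sub (integrable_const _) (i1.div_const _),
    integral_div, integral_div]
  simp

theorem integral_sub_sq_of_map_eq_gaussianReal {Ω : Type*} [MeasurableSpace Ω] {μ : Measure Ω}
    {X : Ω → ℝ} (hXm : Measurable X) {m : ℝ} {v : ℝ≥0} (hX : μ.map X = gaussianReal m v) :
    ∫ ω, (X ω - m) ^ 2 ∂μ = v := by
  have h := variance_fun_id_gaussianReal (μ := m) (v := v)
  rw [variance_eq_integral measurable_id'.aemeasurable, integral_id_gaussianReal, ← hX,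
    integral_map hXm.aemeasurable (by fun_prop)] at h
  exact h

theorem integral_eq_of_map_eq_gaussianReal {Ω : Type*} [MeasurableSpace Ω]
    {μ : Measure Ω} {X : Ω → ℝ} (hXm : Measurable X) {m : ℝ} {v : ℝ≥0}
    (hX : μ.map X = gaussianReal m v) : ∫ ω, X ω ∂μ = m := by
  have h := integral_id_gaussianReal (μ := m) (v := v)
  rw [← hX, integral_map hXm.aemeasurable (by fun_prop)] at h
  exact h

theorem variance_eq_of_map_eq_gaussianReal {Ω : Type*} [MeasurableSpace Ω]
    {μ : Measure Ω} {X : Ω → ℝ} (hXm : Measurable X) {m : ℝ} {v : ℝ≥0}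
    (hX : μ.map X = gaussianReal m v) : Var[X; μ] = v := by
  rw [variance_eq_integral hXm.aemeasurable, integral_eq_of_map_eq_gaussianReal hXm hX,
    integral_sub_sq_of_map_eq_gaussianReal hXm hX]

theorem memLp_of_map_eq_gaussianReal {Ω : Type*} [MeasurableSpace Ω]
    {μ : Measure Ω} {X : Ω → ℝ} (hXm : Measurable X) {m : ℝ} {v : ℝ≥0}
    (hX : μ.map X = gaussianReal m v) : MemLp X 2 μ := by
  have h := memLp_id_gaussianReal' (μ := m) (v := v) 2 (by simp)
  rw [← hX, memLp_map_measure_iff (by fun_prop) hXm.aemeasurable] at h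
  exact h

/-- Lower bound on the information that `Y` carries about a Gaussian variable `X`, in terms of the
mean squared error of a linear predictor. -/
theorem le_toReal_mutualInfo_of_predictor {Ω : Type*} [MeasurableSpace Ω] {μ : Measure Ω}
    [IsProbabilityMeasure μ] {X Y : Ω → ℝ} (hXm : Measurable X) (hYm : Measurable Y)
    {m : ℝ} {v : ℝ≥0} (hv : v ≠ 0) (hX : μ.map X = gaussianReal m v) (hX2 : MemLp X 2 μ)
    (hY2 : MemLp Y 2 μ) (hI : mutualInfo μ X Y ≠ ∞) (b c : ℝ) {D : ℝ≥0} (hD : D ≠ 0) :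
    1 / 2 * Real.log (v / D) - (∫ ω, (X ω - (c + b * Y ω)) ^ 2 ∂μ) / (2 * D) + 1 / 2
      ≤ (mutualInfo μ X Y).toReal := by
  have hv' : (0 : ℝ) < v := by positivity
  have : IsProbabilityMeasure (μ.map X) := Measure.isProbabilityMeasure_map hXm.aemeasurable
  have : IsProbabilityMeasure (μ.map Y) := Measure.isProbabilityMeasure_map hYm.aemeasurable
  have : IsProbabilityMeasure (μ.map fun ω => (X ω, Y ω)) :=
    Measure.isProbabilityMeasure_map (by fun_prop)
  -- `F` pretends that `X` given `Y` is `N(c + bY, D)`. For each fixed `y` its exponential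
  -- integrates to 1 against the law of `X`, so the law of `Y` is irrelevant.
  set F : ℝ × ℝ → ℝ := fun z => logRatio m v (c + b * z.2) D z.1 with hF
  have hFm : Measurable F := measurable_logRatio _ _ _ (by fun_prop) (by fun_prop)
  have i1 : Integrable (fun ω => (X ω - (c + b * Y ω)) ^ 2) μ := by
    refine (integrable_sq_of_memLp hX2 hY2 (-c) 1 (-b)).congr (.of_forall fun ω => ?_)
    simp only
    ring
  have i2 : Integrable (fun ω => (X ω - m) ^ 2) μ := by
    refine (integrable_sq_of_memLp hX2 hY2 (-m) 1 0).congr (.of_forall fun ω => ?_)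
    simp only
    ring
  have hFi : Integrable (fun ω => F (X ω, Y ω)) μ := integrable_logRatio v D i1 i2
  have hFint : ∫ ω, F (X ω, Y ω) ∂μ = 1 / 2 * Real.log (v / D)
      - (∫ ω, (X ω - (c + b * Y ω)) ^ 2 ∂μ) / (2 * D) + 1 / 2 := by
    have h := integral_logRatio (v : ℝ) (D : ℝ) i1 i2
    rw [integral_sub_sq_of_map_eq_gaussianReal hXm hX] at h
    rw [h]
    field_simp
  have hlint : ∫⁻ z, ENNReal.ofReal (Real.exp (F z)) ∂((μ.map X).prod (μ.map Y)) = 1 := by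
    rw [lintegral_prod_symm' _ hFm.exp.ennreal_ofReal]
    have : ∀ y, ∫⁻ x, ENNReal.ofReal (Real.exp (F (x, y))) ∂(μ.map X) = 1 := by
      intro y
      rw [hX, ← setLIntegral_univ, ← withDensity_apply _ MeasurableSet.univ]
      simp only [hF]
      rw [gaussianReal_withDensity_exp_logRatio m _ hv hD]
      simp
    simp [this]
  have hQi : Integrable (fun z => Real.exp (F z)) ((μ.map X).prod (μ.map Y)) := by
    refine ⟨hFm.exp.aestronglyMeasurable, ?_⟩
    rw [hasFiniteIntegral_iff_ofReal (.of_forall fun z => (Real.exp_pos _).le), hlint]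
    simp
  have hQ1 : ∫ z, Real.exp (F z) ∂((μ.map X).prod (μ.map Y)) = 1 := by
    rw [integral_eq_lintegral_of_nonneg_ae (.of_forall fun z => (Real.exp_pos _).le)
      hFm.exp.aestronglyMeasurable, hlint]
    simp
  have hpair : AEMeasurable (fun ω => (X ω, Y ω)) μ := by fun_prop
  have hPi : Integrable F (μ.map fun ω => (X ω, Y ω)) :=
    (integrable_map_measure hFm.aestronglyMeasurable hpair).2 hFi
  have h := integral_le_toReal_klDiv hPi hQi hQ1 hI
  rw [integral_map hpair hFm.aestronglyMeasurable, hFint] at h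
  exact h

/-- The information that a linear signal with independent Gaussian noise carries. -/
theorem klDiv_prod_map_add_noise {ρ : Measure ℝ} [IsProbabilityMeasure ρ] {c g m : ℝ} {s w : ℝ≥0}
    (hs : s ≠ 0) (hw : w ≠ 0)
    (h : (ρ.prod (gaussianReal 0 s)).map (fun z => c + g * z.1 + z.2) = gaussianReal m w) :
    InformationTheory.klDiv ((ρ.prod (gaussianReal 0 s)).map (fun z => (z.1, c + g * z.1 + z.2)))
      (ρ.prod (gaussianReal m w)) = ENNReal.ofReal (1 / 2 * Real.log (w / s)) := by
  have hw' : (0 : ℝ) < w := by positivity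
  have hs' : (0 : ℝ) < s := by positivity
  set ξ := ρ.prod (gaussianReal 0 s)
  set Q := ρ.prod (gaussianReal m w)
  set P := ξ.map (fun z => (z.1, c + g * z.1 + z.2)) with hP
  have hT : Measurable fun z : ℝ × ℝ => (z.1, c + g * z.1 + z.2) := by fun_prop
  have hTs : Measurable fun z : ℝ × ℝ => c + g * z.1 + z.2 := by fun_prop
  have : IsProbabilityMeasure P := Measure.isProbabilityMeasure_map hT.aemeasurable
  -- Given `z.1` the signal really is `N(c + g * z.1, s)`, so `F` is the exact log density of the
  -- joint law with respect to the product.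
  set F : ℝ × ℝ → ℝ := fun z => logRatio m w (c + g * z.1) s z.2 with hF
  have hFm : Measurable F := measurable_logRatio _ _ _ (by fun_prop) (by fun_prop)
  have hFe : Measurable fun z => ENNReal.ofReal (Real.exp (F z)) := hFm.exp.ennreal_ofReal
  have hPQ : P = Q.withDensity fun z => ENNReal.ofReal (Real.exp (F z)) := by
    ext S hS
    rw [hP, Measure.map_apply hT hS, Measure.prod_apply (hT hS), withDensity_apply _ hS,
      ← lintegral_indicator hS, lintegral_prod _ (hFe.indicator hS).aemeasurable]
    refine lintegral_congr fun x => ?_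
    have hsec : MeasurableSet (Prod.mk x ⁻¹' S) := measurable_prodMk_left hS
    have e1 : (fun y => S.indicator (fun z => ENNReal.ofReal (Real.exp (F z))) (x, y))
        = (Prod.mk x ⁻¹' S).indicator fun y =>
          ENNReal.ofReal (Real.exp (logRatio m w (c + g * x) s y)) := by
      ext y
      rfl
    rw [e1, lintegral_indicator hsec, ← withDensity_apply _ hsec,
      gaussianReal_withDensity_exp_logRatio m _ hw hs]
    have e2 := gaussianReal_map_const_add (μ := 0) (v := s) (c + g * x)
    rw [zero_add] at e2
    rw [← e2, Measure.map_apply (by fun_prop) hsec]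
    rfl
  have hac : P ≪ Q := hPQ ▸ withDensity_absolutelyContinuous _ _
  have hllr : llr P Q =ᵐ[P] F := by
    have := Measure.rnDeriv_withDensity Q hFe
    rw [← hPQ] at this
    filter_upwards [hac.ae_le this] with z hz
    rw [llr, hz, ENNReal.toReal_ofReal (Real.exp_pos _).le, Real.log_exp]
  have hnoise : MemLp (fun z : ℝ × ℝ => z.2) 2 ξ :=
    (memLp_id_gaussianReal' (μ := 0) (v := s) 2 (by simp)).comp_snd ρ
  have hact : MemLp (fun z : ℝ × ℝ => c + g * z.1 + z.2) 2 ξ := by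
    have := memLp_id_gaussianReal' (μ := m) (v := w) 2 (by simp)
    rw [← h, memLp_map_measure_iff (by fun_prop) hTs.aemeasurable] at this
    exact this
  have i1 : Integrable (fun z : ℝ × ℝ => (c + g * z.1 + z.2 - (c + g * z.1)) ^ 2) ξ := by
    refine hnoise.integrable_sq.congr (.of_forall fun z => ?_)
    simp only
    ring
  have i2 : Integrable (fun z : ℝ × ℝ => (c + g * z.1 + z.2 - m) ^ 2) ξ :=
    (hact.sub (memLp_const m)).integrable_sq
  have v1 : ∫ z, (c + g * z.1 + z.2 - (c + g * z.1)) ^ 2 ∂ξ = (s : ℝ) := by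
    have := integral_sub_sq_of_map_eq_gaussianReal (μ := ξ) measurable_snd
      (m := 0) (v := s) (by simp [ξ])
    rw [← this]
    congr 1
    ext z
    ring
  have hFP : Integrable F P :=
    (integrable_map_measure hFm.aestronglyMeasurable hT.aemeasurable).2
      (integrable_logRatio w s i1 i2)
  rw [InformationTheory.klDiv_of_ac_of_integrable hac ((integrable_congr hllr).2 hFP),
    integral_congr_ae hllr, hP, integral_map hT.aemeasurable hFm.aestronglyMeasurable,
    integral_logRatio (w : ℝ) (s : ℝ) i1 i2, v1, integral_sub_sq_of_map_eq_gaussianReal hTs h,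
    ← hP]
  -- The two quadratic terms average to `-1/2` and `1/2` and cancel.
  congr 1
  simp only [probReal_univ]
  field_simp
  ring

end Information

/-! ### Affine moment formulas and the residual variance of a regression. -/

section Moments

variable {Ω : Type*} [MeasurableSpace Ω] {μ : Measure Ω} [IsProbabilityMeasure μ]
  {U V W : Ω → ℝ}

theorem memLp_affine (hU : MemLp U 2 μ) (hV : MemLp V 2 μ) (p q r : ℝ) :
    MemLp (fun ω => p + q * U ω + r * V ω) 2 μ :=
  ((memLp_const p).add (hU.const_mul q)).add (hV.const_mul r)

theorem covariance_affine_left (hU : MemLp U 2 μ) (hV : MemLp V 2 μ) (hW : MemLp W 2 μ)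
    (p q r : ℝ) :
    cov[fun ω => p + q * U ω + r * V ω, W; μ] = q * cov[U, W; μ] + r * cov[V, W; μ] := by
  have hqU : MemLp (fun ω => q * U ω) 2 μ := hU.const_mul q
  have hrV : MemLp (fun ω => r * V ω) 2 μ := hV.const_mul r
  have hpU : MemLp (fun ω => p + q * U ω) 2 μ := (memLp_const p).add hqU
  change cov[(fun ω => p + q * U ω) + (fun ω => r * V ω), W; μ] = _
  rw [covariance_add_left hpU hrV hW,
    covariance_const_add_left (hqU.integrable (by norm_num)), covariance_const_mul_left,
    covariance_const_mul_left]

theorem covariance_affine_right (hU : MemLp U 2 μ) (hV : MemLp V 2 μ) (hW : MemLp W 2 μ)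
    (p q r : ℝ) :
    cov[W, fun ω => p + q * U ω + r * V ω; μ] = q * cov[W, U; μ] + r * cov[W, V; μ] := by
  rw [covariance_comm, covariance_affine_left hU hV hW, covariance_comm U, covariance_comm V]

theorem variance_affine (hU : MemLp U 2 μ) (hV : MemLp V 2 μ) (p q r : ℝ) :
    Var[fun ω => p + q * U ω + r * V ω; μ]
      = q ^ 2 * Var[U; μ] + 2 * q * r * cov[U, V; μ] + r ^ 2 * Var[V; μ] := by
  have h := memLp_affine hU hV p q r
  rw [← covariance_self h.aestronglyMeasurable.aemeasurable, covariance_affine_left hU hV h,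
    covariance_affine_right hU hV hU, covariance_affine_right hU hV hV,
    covariance_self hU.aestronglyMeasurable.aemeasurable,
    covariance_self hV.aestronglyMeasurable.aemeasurable, covariance_comm V U]
  ring

theorem integral_affine (hU : MemLp U 2 μ) (hV : MemLp V 2 μ) (p q r : ℝ) :
    ∫ ω, (p + q * U ω + r * V ω) ∂μ = p + q * (∫ ω, U ω ∂μ) + r * ∫ ω, V ω ∂μ := by
  have iU := (hU.integrable (by norm_num)).const_mul q
  have iV := (hV.integrable (by norm_num)).const_mul r
  have iUp : Integrable (fun ω => p + q * U ω) μ := (integrable_const p).add iU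
  rw [integral_add iUp iV, integral_add (integrable_const p) iU, integral_const_mul,
    integral_const_mul]
  simp

theorem integral_sq_affine (hU : MemLp U 2 μ) (hV : MemLp V 2 μ) (p q r : ℝ) :
    ∫ ω, (p + q * U ω + r * V ω) ^ 2 ∂μ
      = q ^ 2 * Var[U; μ] + 2 * q * r * cov[U, V; μ] + r ^ 2 * Var[V; μ]
        + (p + q * (∫ ω, U ω ∂μ) + r * ∫ ω, V ω ∂μ) ^ 2 := by
  have h := variance_eq_sub (memLp_affine hU hV p q r)
  rw [variance_affine hU hV, integral_affine hU hV] at h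
  simp only [Pi.pow_apply] at h
  linarith

theorem covariance_sq_le (hU : MemLp U 2 μ) (hV : MemLp V 2 μ) :
    cov[U, V; μ] ^ 2 ≤ Var[U; μ] * Var[V; μ] := by
  have h : ∀ x : ℝ, 0 ≤ Var[U; μ] * (x * x) + (2 * cov[U, V; μ]) * x + Var[V; μ] := fun x => by
    have := variance_affine hU hV 0 x 1
    have h0 := variance_nonneg (fun ω => 0 + x * U ω + 1 * V ω) μ
    rw [this] at h0
    linarith
  have := discrim_le_zero h
  rw [discrim] at this
  linarith

/-- If `Y` carries finite information about a nondegenerate Gaussian variable `X`, then the residual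
variance `r` of the linear regression of `X` on `Y` is positive, the information is at least
`log (var X / r) / 2`, and the mean squared distance of `Y` from `X` exceeds `r` by an explicit
amount. -/
theorem residual_bound {X Y : Ω → ℝ} (hXm : Measurable X) (hYm : Measurable Y) {m : ℝ} {v : ℝ≥0}
    (hv : v ≠ 0) (hX : μ.map X = gaussianReal m v) (hY2 : MemLp Y 2 μ)
    (hI : mutualInfo μ X Y ≠ ∞) :
    ∃ r : ℝ, 0 < r ∧ r = v - cov[Y, X; μ] ^ 2 / Var[Y; μ] ∧
      1 / 2 * Real.log (v / r) ≤ (mutualInfo μ X Y).toReal ∧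
      ∫ ω, (Y ω - X ω) ^ 2 ∂μ
        = r + (∫ ω, Y ω ∂μ - m) ^ 2 + (Var[Y; μ] - cov[Y, X; μ]) ^ 2 / Var[Y; μ] := by
  have hX2 := memLp_of_map_eq_gaussianReal hXm hX
  have hEX := integral_eq_of_map_eq_gaussianReal hXm hX
  have hVX := variance_eq_of_map_eq_gaussianReal hXm hX
  have hv' : (0 : ℝ) < v := by positivity
  have hcs := covariance_sq_le hY2 hX2
  rw [hVX] at hcs
  have hw0 := variance_nonneg Y μ
  set k := cov[Y, X; μ] with hk
  set w := Var[Y; μ] with hw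
  -- For a constant `Y` the quotients by `w` are 0 by convention; as `k` vanishes too, the formulas
  -- below stay valid.
  have hk0 : w = 0 → k = 0 := fun h => by
    rw [h, zero_mul] at hcs
    exact pow_eq_zero_iff (two_ne_zero) |>.1 (le_antisymm hcs (sq_nonneg _))
  have hle := fun {D : ℝ≥0} (hD : D ≠ 0) => le_toReal_mutualInfo_of_predictor hXm hYm hv hX hX2
    hY2 hI (k / w) (m - k / w * ∫ ω, Y ω ∂μ) hD
  have hres : ∫ ω, (X ω - (m - k / w * (∫ ω, Y ω ∂μ) + k / w * Y ω)) ^ 2 ∂μ = v - k ^ 2 / w := by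
    have h := integral_sq_affine hY2 hX2 (-(m - k / w * (∫ ω, Y ω ∂μ))) (-(k / w)) 1
    rw [hEX, hVX, ← hk, ← hw] at h
    have e : ∀ ω, X ω - (m - k / w * (∫ ω, Y ω ∂μ) + k / w * Y ω)
        = -(m - k / w * (∫ ω, Y ω ∂μ)) + -(k / w) * Y ω + 1 * X ω := fun ω => by ring
    simp only [e, h]
    rcases eq_or_ne w 0 with h0 | h0
    · simp [h0]
    · field_simp
      ring
  simp only [hres] at hle
  have hr0 : 0 ≤ v - k ^ 2 / w := by
    rw [← hres]
    exact integral_nonneg fun ω => sq_nonneg _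
  have hr : 0 < v - k ^ 2 / w := by
    rcases hr0.lt_or_eq with h | h
    · exact h
    -- If `r = 0`, the bound with `D = v exp(-2I)` reads `I + 1/2 ≤ I`, where `I` is the finite
    -- information.
    · exfalso
      set I := (mutualInfo μ X Y).toReal
      have hD : (v * (Real.exp (-(2 * I))).toNNReal : ℝ≥0) ≠ 0 :=
        mul_ne_zero hv (by simp [Real.exp_pos])
      have h2 := hle hD
      rw [← h, NNReal.coe_mul, Real.coe_toNNReal _ (Real.exp_pos _).le] at h2
      have e : (v : ℝ) / (v * Real.exp (-(2 * I))) = Real.exp (2 * I) := by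
        rw [Real.exp_neg]
        field_simp
      rw [e, Real.log_exp] at h2
      simp at h2
      linarith
  refine ⟨v - k ^ 2 / w, hr, rfl, ?_, ?_⟩
  -- The choice `D = r` makes the quadratic term equal to `1/2`, which cancels the constant.
  · have h := hle (D := ⟨v - k ^ 2 / w, hr0⟩) (by
      intro h0
      exact hr.ne' (congrArg NNReal.toReal h0))
    change 1 / 2 * Real.log (v / (v - k ^ 2 / w)) - (v - k ^ 2 / w) / (2 * (v - k ^ 2 / w)) + 1 / 2
      ≤ _ at h
    have e : (v - k ^ 2 / w) / (2 * (v - k ^ 2 / w)) = 1 / 2 := by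
      field_simp
    rw [e] at h
    linarith
  · have h := integral_sq_affine hY2 hX2 0 1 (-1)
    rw [hEX, hVX, ← hk, ← hw] at h
    have e : ∀ ω, Y ω - X ω = 0 + 1 * Y ω + -1 * X ω := fun ω => by ring
    simp only [e, h]
    rcases eq_or_ne w 0 with h0 | h0
    · simp [h0, hk0 h0]
      ring
    · field_simp
      ring

end Moments

/-! ### The scalar problem of choosing the residual variance. -/

section Value

/-- The least value of `r + lam / 2 * log (v / r)` over `0 < r ≤ v`. -/
noncomputable def optimalCost (lam v : ℝ) : ℝ :=
  if lam / 2 < v then lam / 2 + lam / 2 * Real.log (v / (lam / 2)) else v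

/-- Both cases are `log x ≤ x - 1`: at `x = r / (λ/2)` for the interior minimum, and at `x = r / v`
when `v ≤ λ/2` and no information is worth its cost. -/
theorem optimalCost_le {lam v r : ℝ} (hlam : 0 < lam) (hr : 0 < r) (hrv : r ≤ v) :
    optimalCost lam v ≤ r + lam / 2 * Real.log (v / r) := by
  have hv := hr.trans_le hrv
  rw [optimalCost]
  split_ifs with h
  · have h1 := Real.log_le_sub_one_of_pos (x := r / (lam / 2)) (by positivity)
    have h2 : Real.log (r / (lam / 2)) = Real.log (v / (lam / 2)) - Real.log (v / r) := by
      rw [← Real.log_div (by positivity) (by positivity)]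
      congr 1
      field_simp
    rw [h2] at h1
    have h3 := mul_le_mul_of_nonneg_left h1 (by positivity : 0 ≤ lam / 2)
    have h4 : lam / 2 * (r / (lam / 2) - 1) = r - lam / 2 := by field_simp
    linarith
  · push Not at h
    have h1 := Real.log_le_sub_one_of_pos (x := r / v) (by positivity)
    have h0 : Real.log (r / v) = - Real.log (v / r) := by rw [← Real.log_inv, inv_div]
    rw [h0] at h1
    have h2 : v - r ≤ lam / 2 * (1 - r / v) := by
      have : v - r = v * (1 - r / v) := by field_simp
      rw [this]
      exact mul_le_mul_of_nonneg_right h (by rw [sub_nonneg, div_le_one hv]; exact hrv)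
    have h3 : lam / 2 * (1 - r / v) ≤ lam / 2 * Real.log (v / r) :=
      mul_le_mul_of_nonneg_left (by linarith) (by positivity)
    linarith

/-- Uniqueness comes from strictness of `log x < x - 1` for `x ≠ 1`, at the same two points as in
`optimalCost_le`. -/
theorem eq_min_of_le_optimalCost {lam v r : ℝ} (hlam : 0 < lam) (hr : 0 < r) (hrv : r ≤ v)
    (hle : r + lam / 2 * Real.log (v / r) ≤ optimalCost lam v) : r = min v (lam / 2) := by
  have hv := hr.trans_le hrv
  rw [optimalCost] at hle
  split_ifs at hle with h
  · rw [min_eq_right h.le]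
    by_contra hne
    have h1 := Real.log_lt_sub_one_of_pos (x := r / (lam / 2)) (by positivity) (by
      intro h1
      rw [div_eq_one_iff_eq (by positivity)] at h1
      exact hne h1)
    have h2 : Real.log (r / (lam / 2)) = Real.log (v / (lam / 2)) - Real.log (v / r) := by
      rw [← Real.log_div (by positivity) (by positivity)]
      congr 1
      field_simp
    rw [h2] at h1
    have h3 := mul_lt_mul_of_pos_left h1 (by positivity : 0 < lam / 2)
    have h4 : lam / 2 * (r / (lam / 2) - 1) = r - lam / 2 := by field_simp
    linarith
  · push Not at h
    rw [min_eq_left h]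
    by_contra hne
    have hlt := lt_of_le_of_ne hrv hne
    have h1 := Real.log_lt_sub_one_of_pos (x := r / v) (by positivity) (by
      intro h1
      rw [div_eq_one_iff_eq (by positivity)] at h1
      exact hne h1)
    have h0 : Real.log (r / v) = - Real.log (v / r) := by rw [← Real.log_inv, inv_div]
    rw [h0] at h1
    have h2 : v - r ≤ lam / 2 * (1 - r / v) := by
      have : v - r = v * (1 - r / v) := by field_simp
      rw [this]
      exact mul_le_mul_of_nonneg_right h (by rw [sub_nonneg, div_le_one hv]; exact hrv)
    have h3 : lam / 2 * (1 - r / v) < lam / 2 * Real.log (v / r) :=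
      mul_lt_mul_of_pos_left (by linarith) (by positivity)
    linarith

end Value

/-! ### The rate-distortion bound and its equality case for the agent's objective. -/

section Objective

theorem optimalCost_zero {lam : ℝ} (hlam : 0 < lam) : optimalCost lam 0 = 0 := by
  rw [optimalCost, if_neg (by linarith)]

/-- Rate-distortion bound for a Gaussian source `X`. -/
theorem optimalCost_le_loss_add_info {Ω : Type*} [MeasurableSpace Ω] {μ : Measure Ω}
    [IsProbabilityMeasure μ] {X Y : Ω → ℝ} (hXm : Measurable X) (hYm : Measurable Y) {m : ℝ}
    {v : ℝ≥0} (hX : μ.map X = gaussianReal m v) (hY2 : MemLp Y 2 μ) (hI : mutualInfo μ X Y ≠ ∞)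
    {lam : ℝ} (hlam : 0 < lam) :
    optimalCost lam v ≤ ∫ ω, (Y ω - X ω) ^ 2 ∂μ + lam * (mutualInfo μ X Y).toReal := by
  have hI0 : 0 ≤ (mutualInfo μ X Y).toReal := ENNReal.toReal_nonneg
  rcases eq_or_ne v 0 with rfl | hv
  · rw [NNReal.coe_zero, optimalCost_zero hlam]
    have : 0 ≤ ∫ ω, (Y ω - X ω) ^ 2 ∂μ := integral_nonneg fun ω => sq_nonneg _
    positivity
  · obtain ⟨r, hr, hrv, hlog, hloss⟩ := residual_bound hXm hYm hv hX hY2 hI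
    have hw0 := variance_nonneg Y μ
    have hrv' : r ≤ v := by
      have : 0 ≤ cov[Y, X; μ] ^ 2 / Var[Y; μ] := by positivity
      linarith
    have h1 := optimalCost_le hlam hr hrv'
    have h2 : 0 ≤ (Var[Y; μ] - cov[Y, X; μ]) ^ 2 / Var[Y; μ] := by positivity
    have h3 := mul_le_mul_of_nonneg_left hlog hlam.le
    have h4 := sq_nonneg (∫ ω, Y ω ∂μ - m)
    rw [hloss]
    linarith

/-- Moments of the signals that attain the rate-distortion bound. -/
theorem moments_of_loss_add_info_le {Ω : Type*} [MeasurableSpace Ω] {μ : Measure Ω}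
    [IsProbabilityMeasure μ] {X Y : Ω → ℝ} (hXm : Measurable X) (hYm : Measurable Y) {m : ℝ}
    {v : ℝ≥0} (hX : μ.map X = gaussianReal m v) (hY2 : MemLp Y 2 μ) (hI : mutualInfo μ X Y ≠ ∞)
    {lam : ℝ} (hlam : 0 < lam)
    (hle : ∫ ω, (Y ω - X ω) ^ 2 ∂μ + lam * (mutualInfo μ X Y).toReal ≤ optimalCost lam v) :
    ∫ ω, Y ω ∂μ = m ∧ Var[Y; μ] = v - min (v : ℝ) (lam / 2) ∧ cov[Y, X; μ] = Var[Y; μ] := by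
  have hI0 : 0 ≤ (mutualInfo μ X Y).toReal := ENNReal.toReal_nonneg
  have hX2 := memLp_of_map_eq_gaussianReal hXm hX
  have hEX := integral_eq_of_map_eq_gaussianReal hXm hX
  have hVX := variance_eq_of_map_eq_gaussianReal hXm hX
  have hw0 := variance_nonneg Y μ
  rcases eq_or_ne v 0 with rfl | hv
  · rw [NNReal.coe_zero, optimalCost_zero hlam] at hle
    have h0 : 0 ≤ ∫ ω, (Y ω - X ω) ^ 2 ∂μ := integral_nonneg fun ω => sq_nonneg _
    have h1 : ∫ ω, (Y ω - X ω) ^ 2 ∂μ = 0 := le_antisymm (by nlinarith) h0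
    have h2 := integral_sq_affine hY2 hX2 0 1 (-1)
    have e : ∀ ω, 0 + 1 * Y ω + -1 * X ω = Y ω - X ω := fun ω => by ring
    simp only [e] at h2
    have hcs := covariance_sq_le hY2 hX2
    rw [hVX, NNReal.coe_zero, mul_zero] at hcs
    have hk : cov[Y, X; μ] = 0 :=
      pow_eq_zero_iff (two_ne_zero) |>.1 (le_antisymm hcs (sq_nonneg _))
    rw [h1, hVX, hEX, hk, NNReal.coe_zero] at h2
    have h3 := sq_nonneg (0 + 1 * (∫ ω, Y ω ∂μ) + -1 * m)
    have h4 : (0 + 1 * (∫ ω, Y ω ∂μ) + -1 * m) ^ 2 = 0 := by linarith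
    have h5 := pow_eq_zero_iff (two_ne_zero) |>.1 h4
    have h6 : Var[Y; μ] = 0 := by linarith
    refine ⟨by linarith, ?_, by rw [hk, h6]⟩
    rw [h6, NNReal.coe_zero, min_eq_left (by positivity), sub_zero]
  · obtain ⟨r, hr, hrv, hlog, hloss⟩ := residual_bound hXm hYm hv hX hY2 hI
    have hrv' : r ≤ v := by
      have : 0 ≤ cov[Y, X; μ] ^ 2 / Var[Y; μ] := by positivity
      linarith
    have h1 := optimalCost_le hlam hr hrv'
    have h2 : 0 ≤ (Var[Y; μ] - cov[Y, X; μ]) ^ 2 / Var[Y; μ] := by positivity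
    have h3 := mul_le_mul_of_nonneg_left hlog hlam.le
    have h4 := sq_nonneg (∫ ω, Y ω ∂μ - m)
    rw [hloss] at hle
    -- The total cost exceeds the minimum by a sum of nonnegative terms; attaining the minimum
    -- forces each of them to vanish.
    have hr' := eq_min_of_le_optimalCost hlam hr hrv' (by linarith)
    have h5 : (∫ ω, Y ω ∂μ - m) ^ 2 = 0 := by linarith
    have h6 : (Var[Y; μ] - cov[Y, X; μ]) ^ 2 / Var[Y; μ] = 0 := by linarith
    have h7 := pow_eq_zero_iff (two_ne_zero) |>.1 h5
    have hcs := covariance_sq_le hY2 hX2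
    have h8 : cov[Y, X; μ] = Var[Y; μ] := by
      rcases div_eq_zero_iff.1 h6 with h | h
      · have := pow_eq_zero_iff (two_ne_zero) |>.1 h
        linarith
      · rw [h, zero_mul] at hcs
        rw [h]
        exact pow_eq_zero_iff (two_ne_zero) |>.1 (le_antisymm hcs (sq_nonneg _))
    refine ⟨by linarith, ?_, h8⟩
    rw [h8] at hrv
    rw [← hr', hrv]
    rcases eq_or_ne (Var[Y; μ]) 0 with h | h
    · simp [h]
    · field_simp
      ring

@[fun_prop]
theorem measurable_act : Measurable act := measurable_fst

@[fun_prop]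
theorem measurable_agg : Measurable agg := measurable_fst.comp measurable_snd

@[fun_prop]
theorem measurable_state : Measurable state := measurable_snd.comp measurable_snd

@[fun_prop]
theorem measurable_target (α β : ℝ) : Measurable (target α β) := by
  unfold target
  fun_prop

theorem objective_eq_of_ne_top {α β lam : ℝ} (hlam : 0 < lam) {μ : Measure Outcome}
    (h2 : Integrable (fun ω => (act ω - target α β ω) ^ 2) μ)
    (hI : mutualInfo μ (target α β) act ≠ ∞) :
    objective α β lam μ = ((-(∫ ω, (act ω - target α β ω) ^ 2 ∂μ
      + lam * (mutualInfo μ (target α β) act).toReal) : ℝ) : EReal) := by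
  have h0 : 0 ≤ ∫ ω, (act ω - target α β ω) ^ 2 ∂μ := integral_nonneg fun ω => sq_nonneg _
  have hI0 : 0 ≤ lam * (mutualInfo μ (target α β) act).toReal := by positivity
  have hq : quadLoss α β μ = ENNReal.ofReal (∫ ω, (act ω - target α β ω) ^ 2 ∂μ) :=
    (ofReal_integral_eq_lintegral_ofReal h2 (.of_forall fun ω => sq_nonneg _)).symm
  have hc : infoCost α β lam μ
      = ENNReal.ofReal (lam * (mutualInfo μ (target α β) act).toReal) := by
    rw [infoCost, ENNReal.ofReal_mul hlam.le, ENNReal.ofReal_toReal hI]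
  rw [objective, hq, hc, EReal.coe_ennreal_ofReal, EReal.coe_ennreal_ofReal, max_eq_left h0,
    max_eq_left hI0, ← EReal.coe_neg, ← EReal.coe_sub]
  congr 1
  ring

/-- Competing signals are arbitrary, so moments must be earned: a finite loss makes `act - target`
square integrable, and hence `act`, because the target is. -/
theorem objective_eq_bot_or {α β lam : ℝ} (hlam : 0 < lam) {μ : Measure Outcome}
    (hT : MemLp (target α β) 2 μ) :
    objective α β lam μ = ⊥ ∨ (MemLp act 2 μ ∧ mutualInfo μ (target α β) act ≠ ∞ ∧
      objective α β lam μ = ((-(∫ ω, (act ω - target α β ω) ^ 2 ∂μ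
        + lam * (mutualInfo μ (target α β) act).toReal) : ℝ) : EReal)) := by
  by_cases hq : quadLoss α β μ = ∞
  · left
    simp [objective, hq, sub_eq_add_neg]
  by_cases hI : mutualInfo μ (target α β) act = ∞
  · left
    simp [objective, infoCost, hI, ENNReal.mul_top, hlam, sub_eq_add_neg]
  right
  have hm : Measurable fun ω => act ω - target α β ω := by fun_prop
  have h2 : Integrable (fun ω => (act ω - target α β ω) ^ 2) μ := by
    refine ⟨(hm.pow_const 2).aestronglyMeasurable, ?_⟩
    rw [hasFiniteIntegral_iff_ofReal (.of_forall fun ω => sq_nonneg _)]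
    exact lt_top_iff_ne_top.2 hq
  have hd : MemLp (fun ω => act ω - target α β ω) 2 μ :=
    (memLp_two_iff_integrable_sq hm.aestronglyMeasurable).2 h2
  have ha : MemLp act 2 μ := by
    have := hd.add hT
    refine this.ae_eq (.of_forall fun ω => ?_)
    simp
  exact ⟨ha, hI, objective_eq_of_ne_top hlam h2 hI⟩

theorem objective_le {α β lam : ℝ} (hlam : 0 < lam) {μ : Measure Outcome}
    [IsProbabilityMeasure μ] {m : ℝ} {v : ℝ≥0} (hX : μ.map (target α β) = gaussianReal m v) :
    objective α β lam μ ≤ ((-optimalCost lam v : ℝ) : EReal) := by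
  rcases objective_eq_bot_or hlam (memLp_of_map_eq_gaussianReal (measurable_target α β) hX)
    with h | ⟨ha, hI, h⟩
  · rw [h]
    exact bot_le
  · rw [h, EReal.coe_le_coe_iff]
    exact neg_le_neg
      (optimalCost_le_loss_add_info (measurable_target α β) measurable_act hX ha hI hlam)

theorem moments_of_le_objective {α β lam : ℝ} (hlam : 0 < lam) {μ : Measure Outcome}
    [IsProbabilityMeasure μ] {m : ℝ} {v : ℝ≥0} (hX : μ.map (target α β) = gaussianReal m v)
    (hle : ((-optimalCost lam v : ℝ) : EReal) ≤ objective α β lam μ) :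
    ∫ ω, act ω ∂μ = m ∧ Var[act; μ] = v - min (v : ℝ) (lam / 2) ∧
      cov[act, target α β; μ] = Var[act; μ] := by
  rcases objective_eq_bot_or hlam (memLp_of_map_eq_gaussianReal (measurable_target α β) hX)
    with h | ⟨ha, hI, h⟩
  · rw [h] at hle
    exact absurd (le_bot_iff.1 hle) (EReal.coe_ne_bot _)
  · rw [h, EReal.coe_le_coe_iff] at hle
    exact moments_of_loss_add_info_le (measurable_target α β) measurable_act hX ha hI hlam
      (neg_le_neg_iff.1 hle)

end Objective

/-! ### Linear signals with Gaussian noise, and attainment of the bound. -/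

section NoisySignal

/-- The law of `(a_i, A, θ)` if `(A, θ)` has law `ν` and `a_i = c + g (α A + β θ) + e`, where the
noise `e` is independent of `(A, θ)` and has law `N(0, s)`. -/
noncomputable def noisySignal (α β c g : ℝ) (s : ℝ≥0) (ν : Measure (ℝ × ℝ)) : Measure Outcome :=
  (ν.prod (gaussianReal 0 s)).map fun z => (c + g * targetFn α β z.1 + z.2, z.1)

@[fun_prop]
theorem measurable_targetFn' {α β : ℝ} : Measurable (targetFn α β) := measurable_targetFn α β

theorem measurable_noisySignal_map {α β c g : ℝ} :
    Measurable fun z : (ℝ × ℝ) × ℝ => (c + g * targetFn α β z.1 + z.2, z.1) := by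
  fun_prop

theorem noisySignal_map_snd {α β c g : ℝ} {s : ℝ≥0} {ν : Measure (ℝ × ℝ)} :
    (noisySignal α β c g s ν).map Prod.snd = ν := by
  rw [noisySignal, Measure.map_map measurable_snd measurable_noisySignal_map]
  change (ν.prod (gaussianReal 0 s)).map Prod.fst = ν
  simp

theorem gaussianReal_prod_map_add_noise (c g m : ℝ) (v s : ℝ≥0) :
    ((gaussianReal m v).prod (gaussianReal 0 s)).map (fun z => c + g * z.1 + z.2)
      = gaussianReal (c + g * m) (NNReal.mk (g ^ 2) (sq_nonneg g) * v + s) := by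
  have h1 : (gaussianReal m v).map (fun x => c + g * x)
      = gaussianReal (c + g * m) (NNReal.mk (g ^ 2) (sq_nonneg g) * v) := by
    have : (fun x => c + g * x) = (fun x => c + x) ∘ fun x => g * x := rfl
    rw [this, ← Measure.map_map (by fun_prop) (by fun_prop), gaussianReal_map_const_mul,
      gaussianReal_map_const_add, add_comm]
  have h2 := gaussianReal_conv_gaussianReal (m₁ := c + g * m) (m₂ := 0)
    (v₁ := NNReal.mk (g ^ 2) (sq_nonneg g) * v) (v₂ := s)
  rw [add_zero, ← h1, Measure.conv] at h2
  have h3 : ((gaussianReal m v).map (fun x => c + g * x)).prod (gaussianReal 0 s)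
      = ((gaussianReal m v).prod (gaussianReal 0 s)).map (Prod.map (fun x => c + g * x) id) := by
    rw [← Measure.map_prod_map _ _ (by fun_prop) measurable_id, Measure.map_id]
  rw [h3, Measure.map_map (by fun_prop) (by fun_prop)] at h2
  rw [← h2]
  rfl

theorem isGaussian_noisySignal {α β c g : ℝ} {s : ℝ≥0} {ν : Measure (ℝ × ℝ)} [IsGaussian ν] :
    IsGaussian (noisySignal α β c g s ν) := by
  let L : ((ℝ × ℝ) × ℝ) →L[ℝ] Outcome :=
    (((g * α) • (ContinuousLinearMap.fst ℝ ℝ ℝ).comp (ContinuousLinearMap.fst ℝ (ℝ × ℝ) ℝ)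
      + (g * β) • (ContinuousLinearMap.snd ℝ ℝ ℝ).comp (ContinuousLinearMap.fst ℝ (ℝ × ℝ) ℝ))
      + ContinuousLinearMap.snd ℝ (ℝ × ℝ) ℝ).prod (ContinuousLinearMap.fst ℝ (ℝ × ℝ) ℝ)
  have h : noisySignal α β c g s ν
      = ((ν.prod (gaussianReal 0 s)).map L).map (fun x => x + ((c, 0) : Outcome)) := by
    rw [noisySignal, Measure.map_map (by fun_prop) (by fun_prop)]
    congr 1
    ext z
    · simp [L, targetFn]
      ring
    · simp [L]
    · simp [L]
  rw [h]
  infer_instance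

theorem noisySignal_map_comp_snd {α β c g : ℝ} {s : ℝ≥0} {ν : Measure (ℝ × ℝ)}
    {X : ℝ × ℝ → ℝ} (hX : Measurable X) :
    (noisySignal α β c g s ν).map (fun ω => X ω.2) = ν.map X := by
  conv_rhs => rw [← noisySignal_map_snd (α := α) (β := β) (c := c) (g := g) (s := s) (ν := ν)]
  rw [Measure.map_map hX measurable_snd]
  rfl

variable {α β c g : ℝ} {s : ℝ≥0} {ν : Measure (ℝ × ℝ)} [IsProbabilityMeasure ν]

instance : IsProbabilityMeasure (noisySignal α β c g s ν) :=
  Measure.isProbabilityMeasure_map measurable_noisySignal_map.aemeasurable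

theorem isTargetSignal_noisySignal : IsTargetSignal α β (noisySignal α β c g s ν) := by
  have hm : Measurable fun x : ℝ => gaussianReal (c + g * x) s :=
    measurable_gaussianReal.comp (f := fun x : ℝ => (c + g * x, s)) (by fun_prop)
  refine ⟨⟨fun x => gaussianReal (c + g * x) s, hm⟩, ⟨fun x => ?_⟩, ?_⟩
  · change IsProbabilityMeasure (gaussianReal (c + g * x) s)
    infer_instance
  set κ : Kernel ℝ ℝ := ⟨fun x => gaussianReal (c + g * x) s, hm⟩
  have : IsMarkovKernel κ := ⟨fun x => by
    change IsProbabilityMeasure (gaussianReal (c + g * x) s)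
    infer_instance⟩
  rw [noisySignal_map_snd]
  ext S hS
  have hS' : MeasurableSet (Prod.swap ⁻¹' S : Set ((ℝ × ℝ) × ℝ)) := measurable_swap hS
  rw [noisySignal, Measure.map_apply measurable_noisySignal_map hS,
    Measure.prod_apply (measurable_noisySignal_map hS), Measure.map_apply measurable_swap hS,
    Measure.compProd_apply hS']
  refine lintegral_congr fun p => ?_
  have e := gaussianReal_map_const_add (μ := 0) (v := s) (c + g * targetFn α β p)
  rw [zero_add] at e
  change _ = gaussianReal (c + g * targetFn α β p) s _
  rw [← e, Measure.map_apply (by fun_prop) (measurable_prodMk_left hS')]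
  rfl

theorem noisySignal_map_target_act :
    (noisySignal α β c g s ν).map (fun ω => (target α β ω, act ω))
      = ((ν.map (targetFn α β)).prod (gaussianReal 0 s)).map
          (fun z => (z.1, c + g * z.1 + z.2)) := by
  have h : (ν.map (targetFn α β)).prod (gaussianReal 0 s)
      = (ν.prod (gaussianReal 0 s)).map (Prod.map (targetFn α β) id) := by
    rw [← Measure.map_prod_map _ _ (measurable_targetFn α β) measurable_id, Measure.map_id]
  rw [h, noisySignal, Measure.map_map (by fun_prop) measurable_noisySignal_map,
    Measure.map_map (by fun_prop) (by fun_prop)]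
  rfl

section SecondMoments

variable {Y : ℝ × ℝ → ℝ}

theorem integral_act_noisySignal (hT : MemLp (targetFn α β) 2 ν) :
    ∫ ω, act ω ∂(noisySignal α β c g s ν) = c + g * ∫ p, targetFn α β p ∂ν := by
  have hN : MemLp (fun z : (ℝ × ℝ) × ℝ => z.2) 2 (ν.prod (gaussianReal 0 s)) :=
    (memLp_id_gaussianReal' (μ := 0) (v := s) 2 (by simp)).comp_snd ν
  have hT' : MemLp (fun z : (ℝ × ℝ) × ℝ => targetFn α β z.1) 2 (ν.prod (gaussianReal 0 s)) :=
    hT.comp_fst _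
  have h := integral_affine hT' hN c g 1
  rw [integral_fun_fst (μ := ν) (ν := gaussianReal 0 s) (targetFn α β),
    integral_fun_snd (μ := ν) (ν := gaussianReal 0 s) (fun x => x)] at h
  rw [noisySignal, integral_map measurable_noisySignal_map.aemeasurable (by fun_prop)]
  simp only [act]
  simpa using h

theorem variance_act_noisySignal (hT : MemLp (targetFn α β) 2 ν) :
    Var[act; noisySignal α β c g s ν] = g ^ 2 * Var[targetFn α β; ν] + s := by
  have hN0 := memLp_id_gaussianReal' (μ := 0) (v := s) 2 (by simp)
  have hN : MemLp (fun z : (ℝ × ℝ) × ℝ => z.2) 2 (ν.prod (gaussianReal 0 s)) := hN0.comp_snd ν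
  have hT' : MemLp (fun z : (ℝ × ℝ) × ℝ => targetFn α β z.1) 2 (ν.prod (gaussianReal 0 s)) :=
    hT.comp_fst _
  have h := variance_affine hT' hN c g 1
  have e1 : cov[fun z : (ℝ × ℝ) × ℝ => targetFn α β z.1, fun z => z.2;
      ν.prod (gaussianReal 0 s)] = 0 := covariance_fst_snd_prod hT hN0
  have e2 : Var[fun z : (ℝ × ℝ) × ℝ => targetFn α β z.1; ν.prod (gaussianReal 0 s)]
      = Var[targetFn α β; ν] := by
    have := variance_map (X := targetFn α β) (μ := ν.prod (gaussianReal 0 s)) (Y := Prod.fst)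
      (by fun_prop) (by fun_prop)
    rw [Measure.map_fst_prod] at this
    simpa [Function.comp_def] using this.symm
  have e3 : Var[fun z : (ℝ × ℝ) × ℝ => z.2; ν.prod (gaussianReal 0 s)] = s := by
    have := variance_map (X := id) (μ := ν.prod (gaussianReal 0 s)) (Y := Prod.snd)
      (by fun_prop) (by fun_prop)
    rw [Measure.map_snd_prod] at this
    simpa [Function.comp_def] using this.symm
  rw [e1, e2, e3] at h
  rw [noisySignal, variance_map (by fun_prop) measurable_noisySignal_map.aemeasurable]
  simp only [one_mul] at h
  change Var[fun z : (ℝ × ℝ) × ℝ => c + g * targetFn α β z.1 + z.2; _] = _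
  rw [h]
  ring

theorem covariance_act_noisySignal (hT : MemLp (targetFn α β) 2 ν) (hYm : Measurable Y)
    (hY : MemLp Y 2 ν) :
    cov[act, fun ω => Y ω.2; noisySignal α β c g s ν] = g * cov[targetFn α β, Y; ν] := by
  have hN0 := memLp_id_gaussianReal' (μ := 0) (v := s) 2 (by simp)
  have hN : MemLp (fun z : (ℝ × ℝ) × ℝ => z.2) 2 (ν.prod (gaussianReal 0 s)) := hN0.comp_snd ν
  have hT' : MemLp (fun z : (ℝ × ℝ) × ℝ => targetFn α β z.1) 2 (ν.prod (gaussianReal 0 s)) :=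
    hT.comp_fst _
  have hY' : MemLp (fun z : (ℝ × ℝ) × ℝ => Y z.1) 2 (ν.prod (gaussianReal 0 s)) :=
    hY.comp_fst _
  have h := covariance_affine_left hT' hN hY' c g 1
  have e1 : cov[fun z : (ℝ × ℝ) × ℝ => z.2, fun z => Y z.1; ν.prod (gaussianReal 0 s)] = 0 := by
    rw [covariance_comm]
    exact covariance_fst_snd_prod hY hN0
  have e2 : cov[fun z : (ℝ × ℝ) × ℝ => targetFn α β z.1, fun z => Y z.1;
      ν.prod (gaussianReal 0 s)] = cov[targetFn α β, Y; ν] := by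
    have := covariance_map (X := targetFn α β) (Y := Y) (μ := ν.prod (gaussianReal 0 s))
      (Z := Prod.fst) (by fun_prop) (by fun_prop) (by fun_prop)
    rw [Measure.map_fst_prod] at this
    simpa [Function.comp_def] using this.symm
  rw [e1, e2] at h
  have hYm' : Measurable fun ω : Outcome => Y ω.2 := by fun_prop
  rw [noisySignal, covariance_map (by fun_prop) hYm'.aestronglyMeasurable
    measurable_noisySignal_map.aemeasurable]
  simp only [one_mul] at h
  change cov[fun z : (ℝ × ℝ) × ℝ => c + g * targetFn α β z.1 + z.2, fun z => Y z.1; _] = _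
  rw [h]
  ring

end SecondMoments

/-- The regression coefficient on the target of the optimal signal about a target of variance
`v`. -/
noncomputable def optimalSlope (lam v : ℝ) : ℝ := (v - min v (lam / 2)) / v

theorem optimalSlope_mul_self {lam v : ℝ} (hlam : 0 < lam) :
    optimalSlope lam v * v = v - min v (lam / 2) := by
  rw [optimalSlope]
  -- At `v = 0` the slope is `0 / 0 = 0`, and both sides vanish.
  rcases eq_or_ne v 0 with rfl | hv
  · rw [min_eq_left (by positivity)]
    simp
  · field_simp

theorem optimalSlope_nonneg {lam v : ℝ} (hv : 0 ≤ v) : 0 ≤ optimalSlope lam v :=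
  div_nonneg (sub_nonneg.2 (min_le_left _ _)) hv

/-- The optimal signal about a target with law `N(m, v)`. -/
noncomputable def optimalSignal (α β lam m : ℝ) (v : ℝ≥0) (ν : Measure (ℝ × ℝ)) :
    Measure Outcome :=
  noisySignal α β ((1 - optimalSlope lam v) * m) (optimalSlope lam v)
    (optimalSlope lam v * min (v : ℝ) (lam / 2)).toNNReal ν

/-- Write `D = min v (λ/2)` and `g` for the slope, so `g v = v - D`. Noise of variance `g D` makes
the variance of the action `g² v + g D = g v`, equal to its covariance with the target. The
intercept removes the bias, so the mean squared error is `D`. -/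
theorem neg_optimalCost_le_objective_optimalSignal {lam m : ℝ} (hlam : 0 < lam) {v : ℝ≥0}
    (hX : ν.map (targetFn α β) = gaussianReal m v) :
    ((-optimalCost lam v : ℝ) : EReal) ≤ objective α β lam (optimalSignal α β lam m v ν) := by
  have hTm := measurable_targetFn α β
  have hT2 := memLp_of_map_eq_gaussianReal hTm hX
  have hET := integral_eq_of_map_eq_gaussianReal hTm hX
  have hVT := variance_eq_of_map_eq_gaussianReal hTm hX
  have hD0 : 0 ≤ min (v : ℝ) (lam / 2) := by positivity
  have hgv := optimalSlope_mul_self (v := v) hlam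
  have hg0 := optimalSlope_nonneg (lam := lam) v.2
  have hs := Real.coe_toNNReal _ (mul_nonneg hg0 hD0)
  rw [optimalSignal]
  change 0 ≤ optimalSlope lam v at hg0
  change ((optimalSlope lam v * min (v : ℝ) (lam / 2)).toNNReal : ℝ)
    = optimalSlope lam v * min (v : ℝ) (lam / 2) at hs
  set g := optimalSlope lam v with hg
  set D := min (v : ℝ) (lam / 2) with hD
  set s := (g * D).toNNReal
  set μ := noisySignal α β ((1 - g) * m) g s ν with hμ
  have hXμ : μ.map (target α β) = gaussianReal m v := by
    rw [← hX]
    exact noisySignal_map_comp_snd hTm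
  have hTμ := memLp_of_map_eq_gaussianReal (measurable_target α β) hXμ
  have hEμ := integral_eq_of_map_eq_gaussianReal (measurable_target α β) hXμ
  have hVμ := variance_eq_of_map_eq_gaussianReal (measurable_target α β) hXμ
  have hactlaw : μ.map act = gaussianReal ((1 - g) * m + g * m)
      (NNReal.mk (g ^ 2) (sq_nonneg g) * v + s) := by
    have h := congrArg (fun P => Measure.map Prod.snd P)
      (noisySignal_map_target_act (α := α) (β := β) (c := (1 - g) * m) (g := g) (s := s) (ν := ν))
    rw [Measure.map_map measurable_snd (by fun_prop), Measure.map_map measurable_snd (by fun_prop),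
      hX] at h
    exact h.trans (gaussianReal_prod_map_add_noise _ _ _ _ _)
  have ha2 := memLp_of_map_eq_gaussianReal measurable_act hactlaw
  have hL : ∫ ω, (act ω - target α β ω) ^ 2 ∂μ = D := by
    have h := integral_sq_affine ha2 hTμ 0 1 (-1)
    have hc : cov[act, target α β; μ] = g * v := by
      have := covariance_act_noisySignal (c := (1 - g) * m) (g := g) (s := s) hT2 hTm hT2
      rw [covariance_self hTm.aemeasurable, hVT] at this
      exact this
    rw [hEμ, hVμ, hc, variance_act_noisySignal hT2, integral_act_noisySignal hT2, hET, hVT,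
      hs] at h
    have e : ∀ ω, act ω - target α β ω = 0 + 1 * act ω + -1 * target α β ω := fun ω => by ring
    simp only [e]
    rw [h]
    linear_combination (g - 1) * hgv
  have hint : Integrable (fun ω => (act ω - target α β ω) ^ 2) μ := (ha2.sub hTμ).integrable_sq
  have hI : mutualInfo μ (target α β) act
      = ENNReal.ofReal (if lam / 2 < v then 1 / 2 * Real.log (v / (lam / 2)) else 0) := by
    rw [mutualInfo, hXμ, hactlaw, hμ, noisySignal_map_target_act, hX]
    split_ifs with hlt
    · have hDe : D = lam / 2 := min_eq_right hlt.le
      have hv0 : (0 : ℝ) < v := (by positivity : 0 < lam / 2).trans hlt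
      have hgpos : 0 < g := div_pos (sub_pos.2 (by rw [← hD, hDe]; exact hlt)) hv0
      have hspos : 0 < s := Real.toNNReal_pos.2 (by rw [hDe]; positivity)
      rw [klDiv_prod_map_add_noise hspos.ne' (by positivity)
        (gaussianReal_prod_map_add_noise _ _ _ _ _)]
      congr 3
      rw [NNReal.coe_add, NNReal.coe_mul, hs, NNReal.coe_mk]
      have : g ^ 2 * v + g * D = g * v := by linear_combination g * hgv
      rw [this, hDe]
      field_simp
    -- Here slope and noise are zero: the action is the constant `m`, the joint law is the product
    -- of its marginals, and the divergence vanishes.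
    · have hDe : D = v := min_eq_left (not_lt.1 hlt)
      have hg0' : g = 0 := by rw [hg, optimalSlope, ← hD, hDe]; simp
      have hs0 : s = 0 := by simp [s, hg0']
      rw [ENNReal.ofReal_zero]
      have e1 : (NNReal.mk (g ^ 2) (sq_nonneg g) * v + s) = 0 := by
        rw [hs0, add_zero]
        ext
        simp [hg0']
      rw [e1, hs0, hg0']
      have e2 : ((gaussianReal m v).prod (gaussianReal 0 0)).map
          (fun z => (z.1, (1 - 0) * m + 0 * z.1 + z.2))
          = (gaussianReal m v).prod (gaussianReal ((1 - 0) * m + 0 * m) 0) := by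
        have h := Measure.map_prod_map (gaussianReal m v) (gaussianReal 0 0)
          (measurable_id (α := ℝ)) (measurable_const_add m)
        rw [gaussianReal_map_const_add, Measure.map_id] at h
        have e3 : (fun z : ℝ × ℝ => (z.1, (1 - 0) * m + 0 * z.1 + z.2))
            = Prod.map id (fun x => m + x) := by
          ext z <;> simp
        rw [e3, ← h]
        simp
      rw [e2]
      exact InformationTheory.klDiv_self _
  have hItop : mutualInfo μ (target α β) act ≠ ∞ := by
    rw [hI]
    exact ENNReal.ofReal_ne_top
  rw [objective_eq_of_ne_top hlam hint hItop, hL, hI, EReal.coe_le_coe_iff, optimalCost]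
  refine neg_le_neg ?_
  split_ifs with hlt
  · rw [ENNReal.toReal_ofReal, hD, min_eq_right hlt.le]
    · linarith
    · have := Real.log_nonneg (x := v / (lam / 2)) (by rw [le_div_iff₀ (by positivity)]; linarith)
      positivity
  · rw [ENNReal.ofReal_zero, hD, min_eq_left (not_lt.1 hlt)]
    simp

end NoisySignal

/-! ### Consequences of joint normality. -/

section Gaussian

/-- The action as a continuous linear map. -/
def actCLM : Outcome →L[ℝ] ℝ := ContinuousLinearMap.fst ℝ ℝ (ℝ × ℝ)

/-- The aggregate action as a continuous linear map. -/
def aggCLM : Outcome →L[ℝ] ℝ :=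
  (ContinuousLinearMap.fst ℝ ℝ ℝ).comp (ContinuousLinearMap.snd ℝ ℝ (ℝ × ℝ))

/-- The state as a continuous linear map. -/
def stateCLM : Outcome →L[ℝ] ℝ :=
  (ContinuousLinearMap.snd ℝ ℝ ℝ).comp (ContinuousLinearMap.snd ℝ ℝ (ℝ × ℝ))

variable {μ : Measure Outcome} [IsGaussian μ]

theorem hasGaussianLaw_clm {E : Type*} [NormedAddCommGroup E] [NormedSpace ℝ E]
    [MeasurableSpace E] [BorelSpace E] (L : Outcome →L[ℝ] E) : HasGaussianLaw L μ :=
  (IsGaussian.hasGaussianLaw_id (μ := μ)).map L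

theorem memLp_act : MemLp act 2 μ := (hasGaussianLaw_clm (μ := μ) actCLM).memLp_two

theorem memLp_agg : MemLp agg 2 μ := (hasGaussianLaw_clm (μ := μ) aggCLM).memLp_two

theorem memLp_state : MemLp state 2 μ := (hasGaussianLaw_clm (μ := μ) stateCLM).memLp_two

theorem hasGaussianLaw_target (α β : ℝ) : HasGaussianLaw (target α β) μ :=
  hasGaussianLaw_clm (α • aggCLM + β • stateCLM)

theorem target_eq (α β : ℝ) : target α β = fun ω => 0 + α * agg ω + β * state ω := by
  ext ω
  rw [target, zero_add]

/-- A Gaussian law of `(a_i, A, θ)` is determined by its first and second moments. -/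
theorem ext_of_moments {ν : Measure Outcome} [IsGaussian ν]
    (h1 : ∫ ω, act ω ∂μ = ∫ ω, act ω ∂ν) (h2 : ∫ ω, agg ω ∂μ = ∫ ω, agg ω ∂ν)
    (h3 : ∫ ω, state ω ∂μ = ∫ ω, state ω ∂ν) (h11 : Var[act; μ] = Var[act; ν])
    (h22 : Var[agg; μ] = Var[agg; ν]) (h33 : Var[state; μ] = Var[state; ν])
    (h12 : cov[act, agg; μ] = cov[act, agg; ν]) (h13 : cov[act, state; μ] = cov[act, state; ν])
    (h23 : cov[agg, state; μ] = cov[agg, state; ν]) : μ = ν := by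
  apply Measure.ext_of_charFunDual
  ext L
  -- A Gaussian characteristic function depends only on the mean and variance of each linear
  -- functional. The nested form with constants 0 lets the two-variable affine formulas be applied
  -- twice.
  obtain ⟨x, y, z, hL⟩ : ∃ x y z : ℝ, (L : Outcome → ℝ) = fun ω => 0 + x * act ω
      + 1 * (0 + y * agg ω + z * state ω) := by
    refine ⟨L (1, 0, 0), L (0, 1, 0), L (0, 0, 1), ?_⟩
    ext ω
    have : ω = act ω • ((1, 0, 0) : Outcome) + agg ω • ((0, 1, 0) : Outcome)
        + state ω • ((0, 0, 1) : Outcome) := by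
      ext <;> simp [act, agg, state]
    conv_lhs => rw [this]
    simp only [map_add, map_smul, smul_eq_mul]
    ring
  have hE : ∀ (ρ : Measure Outcome) [IsGaussian ρ], ∫ ω, L ω ∂ρ = x * ∫ ω, act ω ∂ρ
      + (y * (∫ ω, agg ω ∂ρ) + z * ∫ ω, state ω ∂ρ) := by
    intro ρ _
    rw [hL, integral_affine memLp_act (memLp_affine memLp_agg memLp_state _ _ _),
      integral_affine memLp_agg memLp_state]
    ring
  have hV : ∀ (ρ : Measure Outcome) [IsGaussian ρ], Var[L; ρ] = x ^ 2 * Var[act; ρ]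
      + 2 * x * (y * cov[act, agg; ρ] + z * cov[act, state; ρ])
      + (y ^ 2 * Var[agg; ρ] + 2 * y * z * cov[agg, state; ρ]
        + z ^ 2 * Var[state; ρ]) := by
    intro ρ _
    rw [hL, variance_affine memLp_act (memLp_affine memLp_agg memLp_state _ _ _),
      variance_affine memLp_agg memLp_state,
      covariance_affine_right memLp_agg memLp_state memLp_act]
    ring
  rw [IsGaussian.charFunDual_eq, IsGaussian.charFunDual_eq, hV μ, hV ν, integral_complex_ofReal,
    integral_complex_ofReal, hE μ, hE ν, h1, h2, h3, h11, h22, h33, h12, h13, h23]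

theorem map_target_eq_gaussianReal (α β : ℝ) :
    μ.map (target α β) = gaussianReal (∫ ω, target α β ω ∂μ) Var[target α β; μ].toNNReal :=
  (hasGaussianLaw_target α β).map_eq_gaussianReal

/-- The conditional mean of the action given `(A, θ)` is `h(T)`, where `h` is the mean of the
kernel. It may be any measurable function, so independence of `T` and `b`, not mere lack of
correlation, is needed to factor `E[h(T) b]`. -/
theorem integral_mul_of_isTargetSignal {α β : ℝ} (h : IsTargetSignal α β μ)
    (b : (ℝ × ℝ) →L[ℝ] ℝ)
    (hind : IndepFun (target α β) (fun ω => b ω.2) μ) :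
    ∫ ω, act ω * b ω.2 ∂μ = (∫ ω, act ω ∂μ) * ∫ ω, b ω.2 ∂μ := by
  obtain ⟨κ, hκ, hμ⟩ := h
  set κ' := κ.comap (targetFn α β) (measurable_targetFn α β) with hκ'
  have hsnd : IsProbabilityMeasure (μ.map Prod.snd) :=
    Measure.isProbabilityMeasure_map measurable_snd.aemeasurable
  set h : ℝ → ℝ := fun x => ∫ y, y ∂(κ x) with hh
  have hhm : StronglyMeasurable h :=
    StronglyMeasurable.integral_kernel (κ := κ) (f := fun y => y) stronglyMeasurable_id
  have key : ∀ B : ℝ × ℝ → ℝ, Measurable B → Integrable (fun ω => act ω * B ω.2) μ →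
      ∫ ω, act ω * B ω.2 ∂μ = ∫ ω, h (target α β ω) * B ω.2 ∂μ := by
    intro B hB hi
    have hmeas : Measurable fun ω : Outcome => act ω * B ω.2 := by fun_prop
    have hi' : Integrable (fun z : (ℝ × ℝ) × ℝ => z.2 * B z.1) (μ.map Prod.snd ⊗ₘ κ') := by
      rw [hμ, integrable_map_measure hmeas.aestronglyMeasurable measurable_swap.aemeasurable] at hi
      exact hi
    have e1 : ∫ ω, act ω * B ω.2 ∂μ = ∫ z, z.2 * B z.1 ∂(μ.map Prod.snd ⊗ₘ κ') := by
      conv_lhs => rw [hμ]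
      rw [integral_map measurable_swap.aemeasurable hmeas.aestronglyMeasurable]
      rfl
    rw [e1, Measure.integral_compProd hi', integral_map measurable_snd.aemeasurable]
    · refine integral_congr_ae (.of_forall fun ω => ?_)
      simp only [integral_mul_const]
      rfl
    · simp only [integral_mul_const]
      exact ((hhm.comp_measurable (measurable_targetFn α β)).mul
        hB.stronglyMeasurable).aestronglyMeasurable
  have hbm : Measurable b := b.continuous.measurable
  have hb2 : MemLp (fun ω : Outcome => b ω.2) 2 μ :=
    (hasGaussianLaw_clm (μ := μ) (b.comp (ContinuousLinearMap.snd ℝ ℝ (ℝ × ℝ)))).memLp_two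
  have k1 := key b hbm (memLp_act.integrable_mul hb2)
  have k2 := key (fun _ => 1) measurable_const (by
    simpa using (memLp_act (μ := μ)).integrable (by norm_num))
  simp only [mul_one] at k2
  rw [k1, k2]
  have hind' : IndepFun (h ∘ target α β) (fun ω => b ω.2) μ :=
    hind.comp (φ := h) (ψ := id) hhm.measurable measurable_id
  exact hind'.integral_mul_eq_mul_integral
    (hhm.comp_measurable (measurable_target α β)).aestronglyMeasurable
    hb2.aestronglyMeasurable

/-- Under a signal about the target, the covariance of the action with a function of `(A, θ)`
is channelled through the target. -/
theorem variance_target_mul_covariance {α β : ℝ} (h : IsTargetSignal α β μ)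
    (y : (ℝ × ℝ) →L[ℝ] ℝ) :
    Var[target α β; μ] * cov[act, fun ω => y ω.2; μ]
      = cov[act, target α β; μ] * cov[target α β, fun ω => y ω.2; μ] := by
  have hT2 : MemLp (target α β) 2 μ := (hasGaussianLaw_target α β).memLp_two
  have hy2 : MemLp (fun ω : Outcome => y ω.2) 2 μ :=
    (hasGaussianLaw_clm (μ := μ) (y.comp (ContinuousLinearMap.snd ℝ ℝ (ℝ × ℝ)))).memLp_two
  rcases eq_or_ne (Var[target α β; μ]) 0 with h0 | h0
  · have hcs := covariance_sq_le (memLp_act (μ := μ)) hT2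
    rw [h0, mul_zero] at hcs
    rw [h0, zero_mul, pow_eq_zero_iff two_ne_zero |>.1 (le_antisymm hcs (sq_nonneg _)), zero_mul]
  -- `δ` is the regression coefficient of `y` on the target. The residual `b` is uncorrelated with
  -- the target, hence independent of it by joint normality.
  set δ := cov[target α β, fun ω => y ω.2; μ] / Var[target α β; μ] with hδ
  let b : (ℝ × ℝ) →L[ℝ] ℝ := y - δ • (α • ContinuousLinearMap.fst ℝ ℝ ℝ
    + β • ContinuousLinearMap.snd ℝ ℝ ℝ)
  have hb : (fun ω : Outcome => b ω.2) = fun ω => 0 + 1 * y ω.2 + -δ * target α β ω := by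
    ext ω
    simp [b, target, agg, state]
    ring
  have hb2 : MemLp (fun ω : Outcome => b ω.2) 2 μ := by
    rw [hb]
    exact memLp_affine hy2 hT2 _ _ _
  have hcov0 : cov[target α β, fun ω => b ω.2; μ] = 0 := by
    rw [hb, covariance_affine_right hy2 hT2 hT2,
      covariance_self hT2.aestronglyMeasurable.aemeasurable, hδ]
    field_simp
    ring
  have hlaw : HasGaussianLaw (fun ω => (target α β ω, b ω.2)) μ :=
    hasGaussianLaw_clm (μ := μ) ((α • aggCLM + β • stateCLM).prod
      (b.comp (ContinuousLinearMap.snd ℝ ℝ (ℝ × ℝ))))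
  have hind := hlaw.indepFun_of_covariance_eq_zero hcov0
  have hz : cov[act, fun ω => b ω.2; μ] = 0 := by
    rw [covariance_eq_sub memLp_act hb2]
    have := integral_mul_of_isTargetSignal h b hind
    simp only [Pi.mul_apply]
    rw [this, sub_self]
  rw [hb, covariance_affine_right hy2 hT2 memLp_act, hδ] at hz
  field_simp at hz
  linarith

/-- The noisy linear signal with the same law of `(A, θ)` is a competitor that attains the bound, so
an optimal signal attains it too and the equality case applies. -/
theorem moments_of_isOptimalSignal {α β lam : ℝ} (hlam : 0 < lam)
    (h : IsOptimalSignal α β lam μ) :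
    ∫ ω, act ω ∂μ = ∫ ω, target α β ω ∂μ ∧
      Var[act; μ] = Var[target α β; μ] - min Var[target α β; μ] (lam / 2) ∧
      cov[act, target α β; μ] = Var[act; μ] := by
  have hX := map_target_eq_gaussianReal (μ := μ) α β
  have hv := Real.coe_toNNReal _ (variance_nonneg (target α β) μ)
  have : IsProbabilityMeasure (μ.map Prod.snd) :=
    Measure.isProbabilityMeasure_map measurable_snd.aemeasurable
  have hX' := hX
  rw [show target α β = targetFn α β ∘ Prod.snd from rfl,
    ← Measure.map_map (measurable_targetFn α β) measurable_snd,
    show targetFn α β ∘ Prod.snd = target α β from rfl] at hX'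
  have h1 := neg_optimalCost_le_objective_optimalSignal hlam hX'
  have h2 := h.2 (optimalSignal α β lam (∫ ω, target α β ω ∂μ) Var[target α β; μ].toNNReal
    (μ.map Prod.snd)) (by rw [optimalSignal]; infer_instance) isTargetSignal_noisySignal
    noisySignal_map_snd
  have h3 := moments_of_le_objective hlam hX (h1.trans h2)
  rwa [hv] at h3

end Gaussian

theorem isOptimalSignal_optimalSignal {α β lam m : ℝ} (hlam : 0 < lam) {v : ℝ≥0}
    {ν : Measure (ℝ × ℝ)} [IsProbabilityMeasure ν]
    (hX : ν.map (targetFn α β) = gaussianReal m v) :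
    IsOptimalSignal α β lam (optimalSignal α β lam m v ν) := by
  refine ⟨isTargetSignal_noisySignal, fun μ' _ _ h => ?_⟩
  refine le_trans (objective_le hlam (m := m) (v := v) ?_)
    (neg_optimalCost_le_objective_optimalSignal hlam hX)
  rw [optimalSignal, noisySignal_map_snd] at h
  rw [← hX, ← h, Measure.map_map (measurable_targetFn α β) measurable_snd]
  rfl

/-! ### Moments, uniqueness and existence of an equilibrium with given information fraction. -/

section Equilibrium

variable {α β lam τ m : ℝ} {μ : Measure Outcome}

theorem one_sub_mul_pos {γ : ℝ} (hα : α < 1) (h0 : 0 ≤ γ) (h1 : γ < 1) : 0 < 1 - α * γ := by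
  nlinarith

theorem f_zero : f α β lam 0 = 2 * β ^ 2 / lam := by
  simp [f]

/-- The moments of an equilibrium in terms of its information fraction. -/
structure HasMoments (α β lam τ m γ : ℝ) (μ : Measure Outcome) : Prop where
  nonneg : 0 ≤ γ
  lt_one : γ < 1
  mean_act : ∫ ω, act ω ∂μ = β * m / (1 - α)
  mean_agg : ∫ ω, agg ω ∂μ = β * m / (1 - α)
  mean_state : ∫ ω, state ω ∂μ = m
  var_state : Var[state; μ] = 1 / τ
  var_act : Var[act; μ] = γ * (β ^ 2 / (τ * (1 - α * γ) ^ 2))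
  var_agg : Var[agg; μ] = (β * γ / (1 - α * γ)) ^ 2 / τ
  cov_agg_state : cov[agg, state; μ] = β * γ / (1 - α * γ) / τ
  eq_or : (0 < γ ∧ τ = f α β lam γ) ∨ (γ = 0 ∧ f α β lam 0 ≤ τ)

theorem IsEquilibrium.hasMoments (hα : α < 1) (hβ : 0 < β) (hlam : 0 < lam) (hτ : 0 < τ)
    (h : IsEquilibrium α β lam τ m μ) :
    HasMoments α β lam τ m (infoFraction α β μ) μ := by
  have := h.gaussian
  have hact := memLp_act (μ := μ)
  have hagg := memLp_agg (μ := μ)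
  have hst := memLp_state (μ := μ)
  obtain ⟨hmean, hvar, hcov⟩ := moments_of_isOptimalSignal hlam h.optimal
  have hET : ∫ ω, target α β ω ∂μ = α * (∫ ω, agg ω ∂μ) + β * m := by
    rw [target_eq, integral_affine hagg hst, h.mean_state, zero_add]
  have c1 := variance_target_mul_covariance h.optimal.1 (ContinuousLinearMap.fst ℝ ℝ ℝ)
  have c2 := variance_target_mul_covariance h.optimal.1 (ContinuousLinearMap.snd ℝ ℝ ℝ)
  change Var[target α β; μ] * cov[act, agg; μ]
    = cov[act, target α β; μ] * cov[target α β, agg; μ] at c1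
  change Var[target α β; μ] * cov[act, state; μ]
    = cov[act, target α β; μ] * cov[target α β, state; μ] at c2
  have t1 : cov[target α β, agg; μ] = α * Var[agg; μ] + β * cov[agg, state; μ] := by
    rw [target_eq, covariance_affine_left hagg hst hagg,
      covariance_self measurable_agg.aemeasurable, covariance_comm state]
  have t2 : cov[target α β, state; μ] = α * cov[agg, state; μ] + β * (1 / τ) := by
    rw [target_eq, covariance_affine_left hagg hst hst,
      covariance_self measurable_state.aemeasurable, h.var_state]
  have t3 : Var[target α β; μ] = α ^ 2 * Var[agg; μ] + 2 * α * β * cov[agg, state; μ]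
      + β ^ 2 * (1 / τ) := by
    rw [target_eq, variance_affine hagg hst, h.var_state]
  have csa := covariance_sq_le hact hagg
  have css := covariance_sq_le hact hst
  rw [t1, hcov, ← h.var_agg] at c1
  rw [t2, hcov, ← h.cov_state] at c2
  rw [← h.var_agg] at csa
  rw [← h.cov_state] at css
  have hv0 := variance_nonneg (target α β) μ
  rw [infoFraction]
  have hmact := h.mean_eq
  have hmst := h.mean_state
  have hvst := h.var_state
  set v := Var[target α β; μ] with hv
  set w := Var[act; μ] with hw
  set q := Var[agg; μ] with hq
  set p := cov[agg, state; μ] with hp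
  -- A deterministic target would make the action deterministic, so `var[A]` and `cov[A, θ]` would
  -- vanish by consistency; the target would then have variance `β² / τ > 0`.
  have hvpos : 0 < v := by
    rcases hv0.lt_or_eq with h0 | h0
    · exact h0
    · exfalso
      rw [← h0, min_eq_left (by positivity), sub_zero] at hvar
      rw [hvar, zero_mul] at csa css
      have hq0 := pow_eq_zero_iff two_ne_zero |>.1 (le_antisymm csa (sq_nonneg _))
      have hp0 := pow_eq_zero_iff two_ne_zero |>.1 (le_antisymm css (sq_nonneg _))
      rw [← h0, hq0, hp0] at t3
      have : 0 < β ^ 2 * (1 / τ) := by positivity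
      linarith
  have hD : 0 < min v (lam / 2) := by positivity
  have hDv : min v (lam / 2) ≤ v := min_le_left _ _
  set γ := w / v with hγ
  have hwγ : w = γ * v := by rw [hγ]; field_simp
  have hγ0 : 0 ≤ γ := div_nonneg (by linarith) hvpos.le
  have hγ1 : γ < 1 := by rw [hγ, div_lt_one hvpos]; linarith
  have hpos := one_sub_mul_pos hα hγ0 hγ1
  -- Consistency and regression through the target give the fixed-point equation `cov[A, θ] = γ
  -- cov[T, θ]`, solvable since `1 - αγ > 0`. The same is done for `var[A]` next.
  have hp' : p = β * γ / (1 - α * γ) / τ := by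
    have : p = γ * (α * p + β * (1 / τ)) := by
      rw [hwγ] at c2
      have : v * p = v * (γ * (α * p + β * (1 / τ))) := by linarith
      exact mul_left_cancel₀ hvpos.ne' this
    rw [eq_div_iff hτ.ne', eq_div_iff hpos.ne']
    field_simp at this
    linarith
  have hq' : q = (β * γ / (1 - α * γ)) ^ 2 / τ := by
    have h1 : q = γ * (α * q + β * p) := by
      rw [hwγ] at c1
      have : v * q = v * (γ * (α * q + β * p)) := by linarith
      exact mul_left_cancel₀ hvpos.ne' this
    have h2 : q = γ * β * p / (1 - α * γ) := by
      rw [eq_div_iff hpos.ne']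
      linarith
    rw [h2, hp']
    field_simp
  have hv' : v = β ^ 2 / (τ * (1 - α * γ) ^ 2) := by
    rw [t3, hq', hp']
    field_simp
    ring
  have h1α : 0 < 1 - α := by linarith
  have hA : ∫ ω, agg ω ∂μ = β * m / (1 - α) := by
    rw [hmean, hET] at hmact
    rw [eq_div_iff h1α.ne']
    linarith
  refine ⟨hγ0, hγ1, hmact.trans hA, hA, hmst, hvst, ?_, hq', hp', ?_⟩
  · rw [← hv', ← hwγ]
  · rcases hγ0.lt_or_eq with h0 | h0
    · left
      refine ⟨h0, ?_⟩
      -- Positive information puts the minimum at `λ/2`, and `(1 - γ) v = λ/2` is then `τ = f γ`.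
      have hlt : lam / 2 < v := by
        by_contra hge
        rw [min_eq_left (not_lt.1 hge), sub_self] at hvar
        rw [hγ, hvar, zero_div] at h0
        exact lt_irrefl _ h0
      rw [min_eq_right hlt.le, hwγ, hv'] at hvar
      rw [f]
      generalize 1 - α * γ = u at hvar hpos ⊢
      field_simp at hvar ⊢
      linarith
    · right
      refine ⟨h0.symm, ?_⟩
      have hle : v ≤ lam / 2 := by
        have : w = 0 := by rw [hwγ, ← h0, zero_mul]
        rw [this] at hvar
        exact min_eq_left_iff.1 (by linarith)
      rw [hv', ← h0] at hle
      rw [f_zero]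
      simp only [mul_zero, sub_zero, one_pow, mul_one] at hle
      rw [div_le_div_iff₀ hτ two_pos] at hle
      rw [div_le_iff₀ hlam]
      linarith

/-- Equilibria are determined by their information fraction. -/
theorem injOn_infoFraction (hα : α < 1) (hβ : 0 < β) (hlam : 0 < lam) (hτ : 0 < τ) :
    Set.InjOn (infoFraction α β) (equilibria α β lam τ m) := by
  intro μ hμ ν hν hγ
  have h1 := hμ.hasMoments hα hβ hlam hτ
  have h2 := hν.hasMoments hα hβ hlam hτ
  have := hμ.gaussian
  have := hν.gaussian
  rw [← hγ] at h2
  apply ext_of_moments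
  · rw [h1.mean_act, h2.mean_act]
  · rw [h1.mean_agg, h2.mean_agg]
  · rw [h1.mean_state, h2.mean_state]
  · rw [h1.var_act, h2.var_act]
  · rw [h1.var_agg, h2.var_agg]
  · rw [h1.var_state, h2.var_state]
  · rw [← hμ.var_agg, ← hν.var_agg, h1.var_agg, h2.var_agg]
  · rw [← hμ.cov_state, ← hν.cov_state, h1.cov_agg_state, h2.cov_agg_state]
  · rw [h1.cov_agg_state, h2.cov_agg_state]

/-- The law of `(A, θ)` if `θ` has law `N(m, 1 / τ)` and `A = a + k (θ - m)`. -/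
noncomputable def aggregateLaw (τ m a k : ℝ) : Measure (ℝ × ℝ) :=
  (gaussianReal m (1 / τ).toNNReal).map fun x => (a + k * (x - m), x)

theorem measurable_aggregateLaw_map (m a k : ℝ) :
    Measurable fun x : ℝ => (a + k * (x - m), x) := by
  fun_prop

instance (τ m a k : ℝ) : IsGaussian (aggregateLaw τ m a k) := by
  let L : ℝ →L[ℝ] ℝ × ℝ :=
    (k • ContinuousLinearMap.id ℝ ℝ).prod (ContinuousLinearMap.id ℝ ℝ)
  have h : aggregateLaw τ m a k = ((gaussianReal m (1 / τ).toNNReal).map L).map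
      (fun x => x + ((a - k * m, 0) : ℝ × ℝ)) := by
    rw [aggregateLaw, Measure.map_map (by fun_prop) (by fun_prop)]
    congr 1
    ext z
    · simp [L]
      ring
    · simp [L]
  rw [h]
  infer_instance

theorem covariance_aggregateLaw (hτ : 0 < τ) {a k : ℝ} {X Y : ℝ × ℝ → ℝ} (hX : Measurable X)
    (hY : Measurable Y) {x₀ x₁ y₀ y₁ : ℝ} (hX' : ∀ x, X (a + k * (x - m), x) = x₀ + x₁ * x)
    (hY' : ∀ x, Y (a + k * (x - m), x) = y₀ + y₁ * x) :
    cov[X, Y; aggregateLaw τ m a k] = x₁ * y₁ / τ := by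
  have hid : MemLp (fun x : ℝ => x) 2 (gaussianReal m (1 / τ).toNNReal) :=
    memLp_id_gaussianReal' 2 (by simp)
  rw [aggregateLaw, covariance_map hX.aestronglyMeasurable hY.aestronglyMeasurable
    (measurable_aggregateLaw_map m a k).aemeasurable]
  have e1 : X ∘ (fun x => (a + k * (x - m), x)) = fun x => x₀ + x₁ * x + 0 * x := by
    ext x
    simp [hX']
  have e2 : Y ∘ (fun x => (a + k * (x - m), x)) = fun x => y₀ + y₁ * x + 0 * x := by
    ext x
    simp [hY']
  rw [e1, e2, covariance_affine_left hid hid (memLp_affine hid hid _ _ _),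
    covariance_affine_right hid hid hid, covariance_self measurable_id'.aemeasurable,
    variance_fun_id_gaussianReal, Real.coe_toNNReal _ (by positivity)]
  ring

theorem integral_aggregateLaw {a k : ℝ} {X : ℝ × ℝ → ℝ} (hX : Measurable X)
    {x₀ x₁ : ℝ} (hX' : ∀ x, X (a + k * (x - m), x) = x₀ + x₁ * x) :
    ∫ p, X p ∂(aggregateLaw τ m a k) = x₀ + x₁ * m := by
  have hid : MemLp (fun x : ℝ => x) 2 (gaussianReal m (1 / τ).toNNReal) :=
    memLp_id_gaussianReal' 2 (by simp)
  rw [aggregateLaw, integral_map (measurable_aggregateLaw_map m a k).aemeasurable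
    hX.aestronglyMeasurable]
  have e1 : ∀ x, X (a + k * (x - m), x) = x₀ + x₁ * x + 0 * x := by
    intro x
    simp [hX']
  simp only [e1]
  rw [integral_affine hid hid, integral_id_gaussianReal]
  ring

theorem aggregateLaw_map_targetFn (hτ : 0 < τ) {a k : ℝ} {c g : ℝ}
    (h : ∀ x, targetFn α β (a + k * (x - m), x) = c + g * (x - m)) :
    (aggregateLaw τ m a k).map (targetFn α β) = gaussianReal c (g ^ 2 / τ).toNNReal := by
  have h' : ∀ x, targetFn α β (a + k * (x - m), x) = (c - g * m) + g * x := by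
    intro x
    rw [h]
    ring
  have hlaw : HasGaussianLaw (targetFn α β) (aggregateLaw τ m a k) :=
    (IsGaussian.hasGaussianLaw_id (μ := aggregateLaw τ m a k)).map
      (α • ContinuousLinearMap.fst ℝ ℝ ℝ + β • ContinuousLinearMap.snd ℝ ℝ ℝ)
  rw [hlaw.map_eq_gaussianReal, integral_aggregateLaw (measurable_targetFn α β) h',
    ← covariance_self (measurable_targetFn α β).aemeasurable,
    covariance_aggregateLaw hτ (measurable_targetFn α β) (measurable_targetFn α β) h' h']
  congr 1
  · ring
  · congr 1
    ring

theorem covariance_comp_snd {ρ : Measure Outcome} {ν : Measure (ℝ × ℝ)}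
    (h : ρ.map Prod.snd = ν) {X Y : ℝ × ℝ → ℝ} (hX : Measurable X) (hY : Measurable Y) :
    cov[fun ω => X ω.2, fun ω => Y ω.2; ρ] = cov[X, Y; ν] := by
  rw [← h, covariance_map hX.aestronglyMeasurable hY.aestronglyMeasurable
    measurable_snd.aemeasurable]
  rfl

theorem integral_comp_snd {ρ : Measure Outcome} {ν : Measure (ℝ × ℝ)}
    (h : ρ.map Prod.snd = ν) {X : ℝ × ℝ → ℝ} (hX : Measurable X) :
    ∫ ω, X ω.2 ∂ρ = ∫ p, X p ∂ν := by
  rw [← h, integral_map measurable_snd.aemeasurable hX.aestronglyMeasurable]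

/-- With `A = a + k (θ - m)` the target is `a + b (θ - m)`, where `b = αk + β`; the choice of `k`
gives `k = γ b`. Consistency thus asks that the optimal signal have slope exactly `γ`, which is what
the condition on `τ` provides. -/
theorem exists_equilibrium (hα : α < 1) (hβ : 0 < β) (hlam : 0 < lam) (hτ : 0 < τ) {γ : ℝ}
    (hγ0 : 0 ≤ γ) (hγ1 : γ < 1)
    (h : (0 < γ ∧ τ = f α β lam γ) ∨ (γ = 0 ∧ f α β lam 0 ≤ τ)) :
    ∃ μ ∈ equilibria α β lam τ m, infoFraction α β μ = γ := by
  have hpos := one_sub_mul_pos hα hγ0 hγ1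
  have h1α : 0 < 1 - α := by linarith
  set a := β * m / (1 - α) with ha
  set k := β * γ / (1 - α * γ) with hk
  set b := β / (1 - α * γ) with hb
  have hbpos : 0 < b := by positivity
  have hkb : k = γ * b := by rw [hk, hb]; ring
  set ν := aggregateLaw τ m a k
  have htf : ∀ x, targetFn α β (a + k * (x - m), x) = a + b * (x - m) := by
    intro x
    have e1 : α * a + β * m = a := by rw [ha]; field_simp; ring
    have e2 : α * k + β = b := by rw [hk, hb]; field_simp; ring
    rw [targetFn]
    linear_combination e1 + (x - m) * e2
  have hX : ν.map (targetFn α β) = gaussianReal a (b ^ 2 / τ).toNNReal :=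
    aggregateLaw_map_targetFn hτ htf
  set v := (b ^ 2 / τ).toNNReal
  have hv : (v : ℝ) = b ^ 2 / τ := Real.coe_toNNReal _ (by positivity)
  have hvpos : (0 : ℝ) < v := by rw [hv]; positivity
  have hslope : optimalSlope lam v = γ := by
    rw [optimalSlope]
    rcases h with ⟨h0, hf⟩ | ⟨h0, hf⟩
    · have e : (v : ℝ) * (1 - γ) = lam / 2 := by
        have h1γ : 0 < 1 - γ := by linarith
        rw [hv, hf, f, hb]
        field_simp
      rw [min_eq_right (by nlinarith), ← e]
      field_simp
      ring
    · have : (v : ℝ) ≤ lam / 2 := by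
        rw [hv, hb, h0, div_le_div_iff₀ hτ two_pos]
        rw [f_zero, div_le_iff₀ hlam] at hf
        simp only [mul_zero, sub_zero, div_one]
        linarith
      rw [min_eq_left this, h0, sub_self, zero_div]
  have hgv := optimalSlope_mul_self (v := (v : ℝ)) hlam
  set μ := optimalSignal α β lam a v ν with hμ
  have hsnd : μ.map Prod.snd = ν := noisySignal_map_snd
  have hTm := measurable_targetFn α β
  have hT2 := memLp_of_map_eq_gaussianReal hTm hX
  have hVT := variance_eq_of_map_eq_gaussianReal hTm hX
  have hET := integral_eq_of_map_eq_gaussianReal hTm hX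
  have hfst2 : MemLp (Prod.fst : ℝ × ℝ → ℝ) 2 ν :=
    ((IsGaussian.hasGaussianLaw_id (μ := ν)).map (ContinuousLinearMap.fst ℝ ℝ ℝ)).memLp_two
  have hsnd2 : MemLp (Prod.snd : ℝ × ℝ → ℝ) 2 ν :=
    ((IsGaussian.hasGaussianLaw_id (μ := ν)).map (ContinuousLinearMap.snd ℝ ℝ ℝ)).memLp_two
  have htf' : ∀ x, targetFn α β (a + k * (x - m), x) = (a - b * m) + b * x := by
    intro x
    rw [htf]
    ring
  have hf' : ∀ x, (Prod.fst : ℝ × ℝ → ℝ) (a + k * (x - m), x) = (a - k * m) + k * x := by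
    intro x
    ring
  have hs' : ∀ x, (Prod.snd : ℝ × ℝ → ℝ) (a + k * (x - m), x) = 0 + 1 * x := by
    intro x
    ring
  have cTf := covariance_aggregateLaw hτ hTm measurable_fst htf' hf'
  have cTs := covariance_aggregateLaw hτ hTm measurable_snd htf' hs'
  have cff := covariance_aggregateLaw hτ measurable_fst measurable_fst hf' hf'
  have cfs := covariance_aggregateLaw hτ measurable_fst measurable_snd hf' hs'
  have css := covariance_aggregateLaw hτ measurable_snd measurable_snd hs' hs'
  have hEact : ∫ ω, act ω ∂μ = a := by
    rw [hμ, optimalSignal, integral_act_noisySignal hT2, hET]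
    ring
  have hVtarget : Var[target α β; μ] = v := by
    rw [← hVT, ← covariance_self (measurable_target α β).aemeasurable,
      ← covariance_self hTm.aemeasurable]
    exact covariance_comp_snd hsnd hTm hTm
  have hVact : Var[act; μ] = γ * v := by
    rw [hslope] at hgv
    rw [hμ, optimalSignal, variance_act_noisySignal hT2, hVT, hslope,
      Real.coe_toNNReal _ (mul_nonneg hγ0 (by positivity))]
    linear_combination γ * hgv
  refine ⟨μ, ⟨isGaussian_noisySignal, ?_, ?_, isOptimalSignal_optimalSignal hlam hX, ?_, ?_, ?_⟩,
    ?_⟩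
  · rw [show (fun ω => state ω) = fun ω : Outcome => Prod.snd ω.2 from rfl,
      integral_comp_snd hsnd measurable_snd, integral_aggregateLaw measurable_snd hs']
    ring
  · rw [← covariance_self measurable_state.aemeasurable]
    refine (covariance_comp_snd hsnd measurable_snd measurable_snd).trans (css.trans ?_)
    ring
  · rw [hEact, show (fun ω => agg ω) = fun ω : Outcome => Prod.fst ω.2 from rfl,
      integral_comp_snd hsnd measurable_fst, integral_aggregateLaw measurable_fst hf']
    ring
  · rw [← covariance_self measurable_agg.aemeasurable]
    refine (covariance_comp_snd hsnd measurable_fst measurable_fst).trans (cff.trans ?_)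
    refine Eq.trans ?_ (covariance_act_noisySignal hT2 measurable_fst hfst2).symm
    rw [cTf, hslope, hkb]
    ring
  · refine (covariance_comp_snd hsnd measurable_fst measurable_snd).trans (cfs.trans ?_)
    refine Eq.trans ?_ (covariance_act_noisySignal hT2 measurable_snd hsnd2).symm
    rw [cTs, hslope, hkb]
    ring
  · rw [infoFraction, hVtarget, hVact]
    field_simp

end Equilibrium

/-! ### Counting the admissible information fractions. -/

section Counting

variable {α β lam τ m : ℝ}

/-- The information fractions of equilibria. -/
def fractions (α β lam τ : ℝ) : Set ℝ :=
  {γ | (0 < γ ∧ τ = f α β lam γ) ∨ (γ = 0 ∧ f α β lam 0 ≤ τ)}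

theorem zero_mem_fractions : (0 : ℝ) ∈ fractions α β lam τ ↔ f α β lam 0 ≤ τ := by
  simp [fractions]

theorem mem_fractions_of_pos {γ : ℝ} (hγ : 0 < γ) :
    γ ∈ fractions α β lam τ ↔ τ = f α β lam γ := by
  simp [fractions, hγ, hγ.ne']

theorem nonneg_of_mem_fractions {γ : ℝ} (h : γ ∈ fractions α β lam τ) : 0 ≤ γ := by
  rcases h with h | h
  · exact h.1.le
  · exact h.1.ge

/-- For `γ ≥ 1` the value of `f` is at most 0, even at a zero of `1 - αγ`, where division gives 0.
Below 1 the denominator is positive and can be cleared. -/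
theorem eq_f_iff (hα : α < 1) (hβ : 0 < β) (hlam : 0 < lam) (hτ : 0 < τ) {γ : ℝ} (hγ : 0 < γ) :
    τ = f α β lam γ ↔ γ < 1 ∧ τ * (1 - α * γ) ^ 2 = f α β lam 0 * (1 - γ) := by
  rw [f_zero]
  constructor
  · intro h
    have hlt : γ < 1 := by
      by_contra hge
      have h1 : (1 - γ) / (1 - α * γ) ^ 2 ≤ 0 :=
        div_nonpos_of_nonpos_of_nonneg (by linarith) (sq_nonneg _)
      have h2 : f α β lam γ ≤ 0 := mul_nonpos_of_nonneg_of_nonpos (by positivity) h1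
      linarith
    have hpos := one_sub_mul_pos hα hγ.le hlt
    refine ⟨hlt, ?_⟩
    rw [h, f]
    generalize 1 - α * γ = u at hpos ⊢
    field_simp
  · rintro ⟨hlt, h⟩
    have hpos := one_sub_mul_pos hα hγ.le hlt
    rw [f, ← mul_div_assoc, eq_div_iff (by positivity)]
    exact h

theorem lt_one_of_mem_fractions (hα : α < 1) (hβ : 0 < β) (hlam : 0 < lam) (hτ : 0 < τ) {γ : ℝ}
    (h : γ ∈ fractions α β lam τ) : γ < 1 := by
  rcases h with h | h
  · exact ((eq_f_iff hα hβ hlam hτ h.1).1 h.2).1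
  · rw [h.1]
    exact one_pos

theorem image_infoFraction (hα : α < 1) (hβ : 0 < β) (hlam : 0 < lam) (hτ : 0 < τ) :
    infoFraction α β '' equilibria α β lam τ m = fractions α β lam τ := by
  ext γ
  constructor
  · rintro ⟨μ, hμ, rfl⟩
    exact (IsEquilibrium.hasMoments hα hβ hlam hτ hμ).eq_or
  · intro h
    exact exists_equilibrium hα hβ hlam hτ (nonneg_of_mem_fractions h)
      (lt_one_of_mem_fractions hα hβ hlam hτ h) h

theorem encard_equilibria (hα : α < 1) (hβ : 0 < β) (hlam : 0 < lam) (hτ : 0 < τ) :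
    (equilibria α β lam τ m).encard = (fractions α β lam τ).encard := by
  rw [← image_infoFraction (m := m) hα hβ hlam hτ,
    (injOn_infoFraction hα hβ hlam hτ).encard_image]

/-- Vieta relations for two distinct roots. -/
theorem vieta (c : ℝ) {x y : ℝ} (hxy : x ≠ y) (hx : τ * (1 - α * x) ^ 2 = c * (1 - x))
    (hy : τ * (1 - α * y) ^ 2 = c * (1 - y)) :
    τ * α ^ 2 * (x + y) = 2 * α * τ - c ∧ τ * α ^ 2 * (x * y) = τ - c := by
  have h1 : τ * α ^ 2 * (x + y) = 2 * α * τ - c := by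
    have : (x - y) * (τ * α ^ 2 * (x + y)) = (x - y) * (2 * α * τ - c) := by
      linear_combination hx - hy
    exact mul_left_cancel₀ (sub_ne_zero.2 hxy) this
  refine ⟨h1, ?_⟩
  linear_combination x * h1 - hx

theorem exists_root {c a b : ℝ} (hab : a ≤ b)
    (h : (τ * (1 - α * a) ^ 2 < c * (1 - a) ∧ c * (1 - b) < τ * (1 - α * b) ^ 2) ∨
      (c * (1 - a) < τ * (1 - α * a) ^ 2 ∧ τ * (1 - α * b) ^ 2 < c * (1 - b))) :
    ∃ x, a < x ∧ x < b ∧ τ * (1 - α * x) ^ 2 = c * (1 - x) := by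
  have hc : ContinuousOn (fun x => τ * (1 - α * x) ^ 2 - c * (1 - x)) (Set.Icc a b) := by
    fun_prop
  rcases h with h | h
  · obtain ⟨x, hx, h0⟩ := intermediate_value_Ioo hab hc
      (show (0 : ℝ) ∈ _ from ⟨by linarith, by linarith⟩)
    exact ⟨x, hx.1, hx.2, by linarith⟩
  · obtain ⟨x, hx, h0⟩ := intermediate_value_Ioo' hab hc
      (show (0 : ℝ) ∈ _ from ⟨by linarith, by linarith⟩)
    exact ⟨x, hx.1, hx.2, by linarith⟩

/-- The intermediate value theorem on `[0, 1]` gives a root. A second positive root is excluded by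
Vieta: the product of two roots would have the sign of `τ - f 0 < 0`. -/
theorem fractions_of_lt (hα : α < 1) (hβ : 0 < β) (hlam : 0 < lam) (hτ : 0 < τ)
    (h : τ < f α β lam 0) : ∃ x, 0 < x ∧ fractions α β lam τ = {x} := by
  have h1α : 0 < 1 - α := by linarith
  have e1 : 0 < τ * (1 - α * 1) ^ 2 := by rw [mul_one]; positivity
  obtain ⟨x, hx0, hx1, hx⟩ := exists_root (α := α) (τ := τ) (c := f α β lam 0) zero_le_one
    (Or.inl ⟨by simpa using h, by simpa using e1⟩)
  refine ⟨x, hx0, ?_⟩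
  ext γ
  rw [Set.mem_singleton_iff]
  constructor
  · rintro (⟨h0, hf⟩ | ⟨-, hf⟩)
    · by_contra hne
      have hv := (vieta _ hne ((eq_f_iff hα hβ hlam hτ h0).1 hf).2 hx).2
      have : 0 ≤ τ * α ^ 2 * (γ * x) := by positivity
      linarith
    · linarith
  · rintro rfl
    exact Or.inl ⟨hx0, (eq_f_iff hα hβ hlam hτ hx0).2 ⟨hx1, hx⟩⟩

theorem f_zero_pos (hβ : 0 < β) (hlam : 0 < lam) : 0 < f α β lam 0 := by
  rw [f_zero]
  positivity

/-- A positive root would satisfy `(1 - αγ)² ≤ 1 - γ`, that is `1 - 2α + α²γ ≤ 0`. Both `1 - 2α` and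
`α²γ` are nonnegative, and they do not vanish together. -/
theorem fractions_of_le_half (hα : α ≤ 1 / 2) (hβ : 0 < β) (hlam : 0 < lam) (hτ : 0 < τ)
    (h : f α β lam 0 ≤ τ) : fractions α β lam τ = {0} := by
  have hα1 : α < 1 := by linarith
  ext γ
  rw [Set.mem_singleton_iff]
  constructor
  · rintro (⟨h0, hf⟩ | ⟨h0, -⟩)
    · exfalso
      obtain ⟨h1, hr⟩ := (eq_f_iff hα1 hβ hlam hτ h0).1 hf
      have hc := f_zero_pos (α := α) hβ hlam
      have e : f α β lam 0 * (1 - α * γ) ^ 2 ≤ f α β lam 0 * (1 - γ) := by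
        rw [← hr]
        exact mul_le_mul_of_nonneg_right h (sq_nonneg _)
      have e2 := le_of_mul_le_mul_left e hc
      have e3 : γ * (1 - 2 * α + α ^ 2 * γ) ≤ γ * 0 := by linarith
      have e4 := le_of_mul_le_mul_left e3 h0
      have e5 : 0 ≤ α ^ 2 * γ := by positivity
      have e6 : α = 1 / 2 := by linarith
      rw [e6] at e4
      linarith
    · exact h0
  · rintro rfl
    exact zero_mem_fractions.2 h

/-- This value is the `τ` at which the discriminant of the quadratic equation vanishes. -/
theorem f_critical (hα : α < 1) (hα' : 1 / 2 < α) :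
    f α β lam ((2 * α - 1) / α) = f α β lam 0 / (4 * α * (1 - α)) := by
  have h1 : 1 - α * ((2 * α - 1) / α) = 2 * (1 - α) := by
    field_simp
    ring
  have h1α : 0 < 1 - α := by linarith
  rw [f_zero, f, h1]
  field_simp
  ring

theorem f_zero_lt_f_critical (hα : α < 1) (hα' : 1 / 2 < α) (hβ : 0 < β) (hlam : 0 < lam) :
    f α β lam 0 < f α β lam ((2 * α - 1) / α) := by
  have hc := f_zero_pos (α := α) hβ hlam
  have h1α : 0 < 1 - α := by linarith
  have h4 : 4 * α * (1 - α) < 1 := by nlinarith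
  rw [f_critical hα hα', lt_div_iff₀ (by positivity)]
  nlinarith

theorem fractions_of_f_critical_lt (hα : α < 1) (hα' : 1 / 2 < α) (hβ : 0 < β) (hlam : 0 < lam)
    (hτ : 0 < τ) (h : f α β lam ((2 * α - 1) / α) < τ) : fractions α β lam τ = {0} := by
  have h0le := (f_zero_lt_f_critical hα hα' hβ hlam).trans h
  have hc := f_zero_pos (α := α) hβ hlam
  have h1α : 0 < 1 - α := by linarith
  rw [f_critical hα hα', div_lt_iff₀ (by positivity)] at h
  ext γ
  rw [Set.mem_singleton_iff]
  constructor
  · rintro (⟨h0, hf⟩ | ⟨h0, -⟩)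
    · exfalso
      obtain ⟨h1, hr⟩ := (eq_f_iff hα hβ hlam hτ h0).1 hf
      set c := f α β lam 0
      -- Completing the square; the right-hand side is the discriminant, negative here.
      have e : (2 * τ * α ^ 2 * γ + c - 2 * α * τ) ^ 2 = c * (c - τ * (4 * α * (1 - α))) := by
        linear_combination 4 * τ * α ^ 2 * hr
      have e2 : c * (c - τ * (4 * α * (1 - α))) < 0 := mul_neg_of_pos_of_neg hc (by linarith)
      rw [← e] at e2
      exact absurd (sq_nonneg _) (not_le.2 e2)
    · exact h0
  · rintro rfl
    exact zero_mem_fractions.2 h0le.le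

theorem fractions_of_eq_f_zero (hα : α < 1) (hα' : 1 / 2 < α) (hβ : 0 < β) (hlam : 0 < lam)
    (hτ : 0 < τ) (h : τ = f α β lam 0) : ∃ x, 0 < x ∧ fractions α β lam τ = {0, x} := by
  have hα0 : 0 < α := by linarith
  have hx0 : 0 < (2 * α - 1) / α ^ 2 := div_pos (by linarith) (by positivity)
  -- For `τ = f 0` the constant term of the quadratic vanishes, so one root is 0 and this is the
  -- other.
  refine ⟨(2 * α - 1) / α ^ 2, hx0, ?_⟩
  ext γ
  rw [Set.mem_insert_iff, Set.mem_singleton_iff]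
  constructor
  · rintro (⟨h0, hf⟩ | ⟨h0, -⟩)
    · right
      obtain ⟨h1, hr⟩ := (eq_f_iff hα hβ hlam hτ h0).1 hf
      rw [← h] at hr
      have e := mul_left_cancel₀ hτ.ne' hr
      have e2 : γ * (α ^ 2 * γ) = γ * (2 * α - 1) := by linear_combination e
      have e3 := mul_left_cancel₀ h0.ne' e2
      rw [eq_div_iff (by positivity)]
      linarith
    · exact Or.inl h0
  · rintro (rfl | rfl)
    · exact zero_mem_fractions.2 h.ge
    · refine Or.inl ⟨hx0, (eq_f_iff hα hβ hlam hτ hx0).2 ⟨?_, ?_⟩⟩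
      · rw [div_lt_one (by positivity)]
        nlinarith
      · rw [← h]
        field_simp
        ring

theorem critical_pos (hα' : 1 / 2 < α) : 0 < (2 * α - 1) / α :=
  div_pos (by linarith) (by linarith)

theorem critical_lt_one (hα : α < 1) (hα' : 1 / 2 < α) : (2 * α - 1) / α < 1 := by
  rw [div_lt_one (by linarith)]
  linarith

theorem fractions_of_eq_f_critical (hα : α < 1) (hα' : 1 / 2 < α) (hβ : 0 < β) (hlam : 0 < lam)
    (hτ : 0 < τ) (h : τ = f α β lam ((2 * α - 1) / α)) :
    ∃ x, 0 < x ∧ fractions α β lam τ = {0, x} := by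
  have hα0 : 0 < α := by linarith
  have h1α : 0 < 1 - α := by linarith
  have hx0 := critical_pos hα'
  refine ⟨(2 * α - 1) / α, hx0, ?_⟩
  ext γ
  rw [Set.mem_insert_iff, Set.mem_singleton_iff]
  constructor
  · rintro (⟨h0, hf⟩ | ⟨h0, -⟩)
    · right
      obtain ⟨h1, hr⟩ := (eq_f_iff hα hβ hlam hτ h0).1 hf
      rw [f_critical hα hα', eq_div_iff (by positivity)] at h
      rw [← h] at hr
      -- The discriminant is zero, so the quadratic is a perfect square with a double root.
      have e : τ * (α * γ - (2 * α - 1)) ^ 2 = 0 := by linear_combination hr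
      have e2 := pow_eq_zero_iff two_ne_zero |>.1 ((mul_eq_zero.1 e).resolve_left hτ.ne')
      rw [eq_div_iff (by positivity)]
      linarith
    · exact Or.inl h0
  · rintro (rfl | rfl)
    · exact zero_mem_fractions.2 (h ▸ (f_zero_lt_f_critical hα hα' hβ hlam).le)
    · exact (mem_fractions_of_pos hx0).2 h

/-- The quadratic is positive at 0, negative at `(2α - 1)/α` and positive at 1, which gives a root
on either side of the critical point. A third root would have the same Vieta sum with both of them.
-/
theorem fractions_of_between (hα : α < 1) (hα' : 1 / 2 < α) (hβ : 0 < β) (hlam : 0 < lam)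
    (hτ : 0 < τ) (h : f α β lam 0 < τ) (h' : τ < f α β lam ((2 * α - 1) / α)) :
    ∃ x y, 0 < x ∧ x < y ∧ fractions α β lam τ = {0, x, y} := by
  have hα0 : 0 < α := by linarith
  have h1α : 0 < 1 - α := by linarith
  have hx0 := critical_pos hα'
  have hx1 := critical_lt_one hα hα'
  rw [f_critical hα hα', lt_div_iff₀ (by positivity)] at h'
  have e1 : 1 - α * ((2 * α - 1) / α) = 2 * (1 - α) := by
    field_simp
    ring
  have e2 : 1 - (2 * α - 1) / α = (1 - α) / α := by
    field_simp
    ring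
  have hz : τ * (1 - α * ((2 * α - 1) / α)) ^ 2 < f α β lam 0 * (1 - (2 * α - 1) / α) := by
    rw [e1, e2, ← mul_div_assoc, lt_div_iff₀ hα0]
    have := mul_lt_mul_of_pos_right h' h1α
    linarith
  have e3 : 0 < τ * (1 - α * 1) ^ 2 := by rw [mul_one]; positivity
  obtain ⟨x, hx, hxz, hxr⟩ := exists_root hx0.le (Or.inr ⟨by simpa using h, hz⟩)
  obtain ⟨y, hzy, hy1, hyr⟩ := exists_root hx1.le (Or.inl ⟨hz, by simpa using e3⟩)
  have hxy := hxz.trans hzy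
  have hy0 := hx.trans hxy
  refine ⟨x, y, hx, hxy, ?_⟩
  ext γ
  rw [Set.mem_insert_iff, Set.mem_insert_iff, Set.mem_singleton_iff]
  constructor
  · rintro (⟨h0, hf⟩ | ⟨h0, -⟩)
    · right
      by_contra hne
      push Not at hne
      have hr := ((eq_f_iff hα hβ hlam hτ h0).1 hf).2
      have v1 := (vieta _ hne.1 hr hxr).1
      have v2 := (vieta _ hne.2 hr hyr).1
      have : τ * α ^ 2 * (γ + x) = τ * α ^ 2 * (γ + y) := v1.trans v2.symm
      have := mul_left_cancel₀ (by positivity) this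
      linarith
    · exact Or.inl h0
  · rintro (rfl | rfl | rfl)
    · exact zero_mem_fractions.2 h.le
    · exact (mem_fractions_of_pos hx).2 ((eq_f_iff hα hβ hlam hτ hx).2 ⟨hxy.trans hy1, hxr⟩)
    · exact (mem_fractions_of_pos hy0).2 ((eq_f_iff hα hβ hlam hτ hy0).2 ⟨hy1, hyr⟩)

end Counting

/-! ### Second moments in closed form. -/

section Moments

variable {α β lam τ m γ : ℝ} {μ : Measure Outcome}

theorem HasMoments.var_act_of_eq_f (hα : α < 1) (hβ : 0 < β) (hlam : 0 < lam)
    (h : HasMoments α β lam τ m γ μ) (hf : τ = f α β lam γ) :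
    Var[act; μ] = lam * γ / (2 * (1 - γ)) := by
  have h1 := one_sub_mul_pos hα h.nonneg h.lt_one
  have h2 : 0 < 1 - γ := by linarith [h.lt_one]
  rw [h.var_act, hf, f]
  generalize 1 - α * γ = u at h1 ⊢
  field_simp

theorem HasMoments.var_agg_eq (h : HasMoments α β lam τ m γ μ) :
    Var[agg; μ] = γ * Var[act; μ] := by
  rw [h.var_act, h.var_agg]
  generalize 1 - α * γ = u
  ring

/-- With `k = βγ / (1 - αγ)`, the variance of `A - kθ` is `k²/τ - 2k²/τ + k²/τ = 0`, so this
variable is almost surely constant. -/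
theorem HasMoments.ae_agg_sub_mean_eq [IsGaussian μ] (h : HasMoments α β lam τ m γ μ) :
    ∀ᵐ ω ∂μ, agg ω - ∫ ω', agg ω' ∂μ = β * γ * (state ω - m) / (1 - α * γ) := by
  have h2 := memLp_affine (memLp_agg (μ := μ)) memLp_state 0 1 (-(β * γ / (1 - α * γ)))
  have hv : Var[fun ω => 0 + 1 * agg ω + -(β * γ / (1 - α * γ)) * state ω; μ] = 0 := by
    rw [variance_affine memLp_agg memLp_state, h.var_agg, h.cov_agg_state, h.var_state]
    ring
  filter_upwards [ae_eq_integral_of_variance_eq_zero h2 hv] with ω hω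
  rw [integral_affine memLp_agg memLp_state, h.mean_state] at hω
  linear_combination hω

end Moments

end LQG

/-! ### Assembly of the theorem. -/

theorem mainTheorem1 (α β lam τ m : ℝ) (hα : α < 1) (hβ : 0 < β) (hlam : 0 < lam) (hτ : 0 < τ) :
    -- equilibria with positive information fraction
    (∀ γ : ℝ, 0 < γ →
      ((∃ μ ∈ LQG.equilibria α β lam τ m, LQG.infoFraction α β μ = γ) ↔
        τ = LQG.f α β lam γ)) ∧
    ((∃ μ ∈ LQG.equilibria α β lam τ m, 0 < LQG.infoFraction α β μ) ↔
      ∃ γ : ℝ, 0 < γ ∧ τ = LQG.f α β lam γ) ∧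
    -- equilibria with information fraction zero
    ((∃ μ ∈ LQG.equilibria α β lam τ m, LQG.infoFraction α β μ = 0) ↔
      LQG.f α β lam 0 ≤ τ) ∧
    -- (i)
    (α ≤ 1 / 2 →
      (LQG.equilibria α β lam τ m).encard = 1 ∧
      (τ < LQG.f α β lam 0 →
        ∀ μ ∈ LQG.equilibria α β lam τ m, 0 < LQG.infoFraction α β μ) ∧
      (LQG.f α β lam 0 ≤ τ →
        ∀ μ ∈ LQG.equilibria α β lam τ m, LQG.infoFraction α β μ = 0)) ∧
    -- (ii)
    (1 / 2 < α →
      (τ < LQG.f α β lam 0 →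
        (LQG.equilibria α β lam τ m).encard = 1 ∧
        ∀ μ ∈ LQG.equilibria α β lam τ m, 0 < LQG.infoFraction α β μ) ∧
      (LQG.f α β lam ((2 * α - 1) / α) < τ →
        (LQG.equilibria α β lam τ m).encard = 1 ∧
        ∀ μ ∈ LQG.equilibria α β lam τ m, LQG.infoFraction α β μ = 0) ∧
      (τ = LQG.f α β lam 0 ∨ τ = LQG.f α β lam ((2 * α - 1) / α) →
        (LQG.equilibria α β lam τ m).encard = 2 ∧
        ∃! μ, μ ∈ LQG.equilibria α β lam τ m ∧ LQG.infoFraction α β μ = 0) ∧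
      (LQG.f α β lam 0 < τ → τ < LQG.f α β lam ((2 * α - 1) / α) →
        (LQG.equilibria α β lam τ m).encard = 3 ∧
        ∃! μ, μ ∈ LQG.equilibria α β lam τ m ∧ LQG.infoFraction α β μ = 0)) ∧
    -- means
    (∀ μ ∈ LQG.equilibria α β lam τ m,
      ∫ ω, LQG.act ω ∂μ = β * m / (1 - α) ∧ ∫ ω, LQG.agg ω ∂μ = β * m / (1 - α)) ∧
    -- second moments
    (∀ μ ∈ LQG.equilibria α β lam τ m, ∀ γ : ℝ, γ = LQG.infoFraction α β μ →
      τ = LQG.f α β lam γ →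
      (∀ᵐ ω ∂μ, LQG.agg ω - ∫ ω', LQG.agg ω' ∂μ =
        β * γ * (LQG.state ω - m) / (1 - α * γ)) ∧
      Var[LQG.act; μ] = lam * γ / (2 * (1 - γ)) ∧
      cov[LQG.act, LQG.agg; μ] = Var[LQG.agg; μ] ∧
      Var[LQG.agg; μ] = γ * Var[LQG.act; μ] ∧
      γ * Var[LQG.act; μ] = lam * γ ^ 2 / (2 * (1 - γ)) ∧
      cov[LQG.act, LQG.state; μ] = cov[LQG.agg, LQG.state; μ] ∧
      cov[LQG.agg, LQG.state; μ] =
        (Var[LQG.act; μ] - α * cov[LQG.act, LQG.agg; μ]) / β ∧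
      (Var[LQG.act; μ] - α * cov[LQG.act, LQG.agg; μ]) / β =
        lam * γ * (1 - α * γ) / (2 * β * (1 - γ))) := by
  -- The information fraction is a bijection from equilibria onto `LQG.fractions`, so existence and
  -- counting claims transfer to that set of reals.
  have himg := LQG.image_infoFraction (m := m) hα hβ hlam hτ
  have hinj := LQG.injOn_infoFraction (m := m) hα hβ hlam hτ
  have hcard := LQG.encard_equilibria (m := m) hα hβ hlam hτ
  have hex : ∀ γ, (∃ μ ∈ LQG.equilibria α β lam τ m, LQG.infoFraction α β μ = γ) ↔
      γ ∈ LQG.fractions α β lam τ := fun γ => by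
    rw [← himg]
    rfl
  have hmem : ∀ μ ∈ LQG.equilibria α β lam τ m,
      LQG.infoFraction α β μ ∈ LQG.fractions α β lam τ := fun μ hμ => (hex _).1 ⟨μ, hμ, rfl⟩
  have hzero : LQG.f α β lam 0 ≤ τ →
      ∃! μ, μ ∈ LQG.equilibria α β lam τ m ∧ LQG.infoFraction α β μ = 0 := fun h => by
    obtain ⟨μ, hμ, h0⟩ := (hex 0).2 (LQG.zero_mem_fractions.2 h)
    exact ⟨μ, ⟨hμ, h0⟩, fun ν hν => hinj hν.1 hμ (hν.2.trans h0.symm)⟩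
  have hlow : τ < LQG.f α β lam 0 → (LQG.equilibria α β lam τ m).encard = 1 ∧
      ∀ μ ∈ LQG.equilibria α β lam τ m, 0 < LQG.infoFraction α β μ := fun h => by
    obtain ⟨x, hx, hF⟩ := LQG.fractions_of_lt hα hβ hlam hτ h
    rw [hF] at hcard hmem
    refine ⟨by rw [hcard, Set.encard_singleton], fun μ hμ => ?_⟩
    rw [Set.mem_singleton_iff.1 (hmem μ hμ)]
    exact hx
  have hhigh : LQG.fractions α β lam τ = {0} → (LQG.equilibria α β lam τ m).encard = 1 ∧
      ∀ μ ∈ LQG.equilibria α β lam τ m, LQG.infoFraction α β μ = 0 := fun hF => by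
    rw [hF] at hcard hmem
    exact ⟨by rw [hcard, Set.encard_singleton], hmem⟩
  refine ⟨fun γ hγ => (hex γ).trans (LQG.mem_fractions_of_pos hγ), ?_,
    (hex 0).trans LQG.zero_mem_fractions, fun hα2 => ?_, fun hα2 => ⟨hlow, ?_, ?_, ?_⟩, ?_, ?_⟩
  · constructor
    · rintro ⟨μ, hμ, h0⟩
      exact ⟨_, h0, (LQG.mem_fractions_of_pos h0).1 (hmem μ hμ)⟩
    · rintro ⟨γ, h0, hf⟩
      obtain ⟨μ, hμ, h⟩ := (hex γ).2 ((LQG.mem_fractions_of_pos h0).2 hf)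
      exact ⟨μ, hμ, h ▸ h0⟩
  · refine ⟨?_, fun h => (hlow h).2,
      fun h => (hhigh (LQG.fractions_of_le_half hα2 hβ hlam hτ h)).2⟩
    rcases lt_or_ge τ (LQG.f α β lam 0) with h | h
    · exact (hlow h).1
    · exact (hhigh (LQG.fractions_of_le_half hα2 hβ hlam hτ h)).1
  · exact fun h => hhigh (LQG.fractions_of_f_critical_lt hα hα2 hβ hlam hτ h)
  · intro h
    obtain ⟨x, hx, hF⟩ : ∃ x, 0 < x ∧ LQG.fractions α β lam τ = {0, x} := by
      rcases h with h | h
      · exact LQG.fractions_of_eq_f_zero hα hα2 hβ hlam hτ h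
      · exact LQG.fractions_of_eq_f_critical hα hα2 hβ hlam hτ h
    refine ⟨by rw [hcard, hF, Set.encard_pair hx.ne], hzero ?_⟩
    rw [← LQG.zero_mem_fractions, hF]
    exact Set.mem_insert _ _
  · intro h h'
    obtain ⟨x, y, hx, hxy, hF⟩ := LQG.fractions_of_between hα hα2 hβ hlam hτ h h'
    refine ⟨?_, hzero h.le⟩
    rw [hcard, hF, Set.encard_eq_three]
    exact ⟨0, x, y, hx.ne, (hx.trans hxy).ne, hxy.ne, rfl⟩
  · intro μ hμ
    have h := LQG.IsEquilibrium.hasMoments hα hβ hlam hτ hμ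
    exact ⟨h.mean_act, h.mean_agg⟩
  · rintro μ hμ γ rfl hf
    have h := LQG.IsEquilibrium.hasMoments hα hβ hlam hτ hμ
    have := hμ.gaussian
    have hva := h.var_act_of_eq_f hα hβ hlam hf
    have hagg := h.var_agg_eq
    have hlt : 0 < 1 - LQG.infoFraction α β μ := by linarith [h.lt_one]
    have hpos := LQG.one_sub_mul_pos hα h.nonneg h.lt_one
    refine ⟨h.ae_agg_sub_mean_eq, hva, hμ.var_agg.symm, hagg, ?_, hμ.cov_state.symm, ?_, ?_⟩
    · rw [hva]
      ring
    · rw [← hμ.var_agg, hagg, h.var_act, h.cov_agg_state]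
      generalize LQG.infoFraction α β μ = γ at hpos ⊢
      have e : γ * (β ^ 2 / (τ * (1 - α * γ) ^ 2)) - α * (γ * (γ * (β ^ 2 / (τ * (1 - α * γ) ^ 2))))
          = γ * (β ^ 2 / (τ * (1 - α * γ) ^ 2)) * (1 - α * γ) := by ring
      rw [e]
      generalize 1 - α * γ = u at hpos ⊢
      field_simp
    · rw [← hμ.var_agg, hagg, hva]
      field_simp
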